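/- Fix $d\in\mathbb N$. Let $\Lambda\subset\mathbb Z^d$ (finite or infinite), with the induced nearest-neighbour graph structure; $d(x,y)$ denotes the graph distance in $\Lambda$ ($=\infty$ in different components), $\operatorname{diam}$ the diameter with respect to it, and $(\delta_u)_{u\in\Lambda}$ the canonical basis of $\ell^2(\Lambda)$; scalar products are linear in the second entry. The support of a bounded operator $A$ is the set of $u$ such that $\langle\delta_v,A\delta_u\rangle\ne0$ or $\langle\delta_u,A\delta_v\rangle\neq0$ for some $v\in\Lambda$. Let $R,I\in\mathbb N$, $N\ge 0$. An $(R,I,N)$-local Lindbladian is $$\mathcal L(\rho)=\sum_{Z\subset\Lambda}\Big(-i[h_Z,\rho]+\mathcal D_Z(\rho)\Big),\qquad \mathcal D_Z(\rho)=\sum_{\alpha\in I_Z}\Big(L_\alpha\rho L_\alpha^*-\tfrac12(L_\alpha^*L_\alpha\rho+\rho L_\alpha^*L_\alpha)\Big),$$ where $h_Z=h_Z^*$ and $L_\alpha$ ($\alpha\in I_Z$) are supported in $Z$ and vanish if $\operatorname{diam}Z>R$, $|I_Z|\le I$, $\|h_Z\|\le N$ and $\|L_\alpha\|\le N$. Distances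 $\mathrm{dist}$ between sets (and of a point to a set) are infima of distances of points, measured by the graph distance of $\mathbb Z^d$ or, alternatively, of $\Lambda$; the result holds for either choice, made once and for all ($\mathrm{dist}=\infty$ if a set is empty). For $S\subset\Lambda$ and $r\in\mathbb N$ let $\partial_rS=\{u\in\Lambda:\max\{\mathrm{dist}(u,S),\mathrm{dist}(u,\Lambda\setminus S)\}\le r\}$. An admissible boundary Lindbladian on $S$ is an $(R,I,N)$-local Lindbladian $\mathcal B_S$, with terms $b_Z$ and $B_\alpha$ ($\alpha\in J_Z$), all of which vanish unless $Z\in\partial_S:=\{Z\subset S:\operatorname{diam}Z\le R,\ \mathrm{dist}(Z,\Lambda\setminus S)\le R\}$. Let $x,y\in\Lambda$ with $3R<d(x,y)<\infty$ and put $\Lambda_x=\{u:d(x,u)\le d(x,y)/3\}$, $\Lambda_y=\{u:d(y,u)\le d(x,y)/3\}$, $\Lambda_1=\Lambda_x\uplus\Lambda_y$, $\Lambda_2=\Lambda\setminus\Lambda_1$. Let $\mathcal B_{\Lambda_1},\mathcal B_{\Lambda_2}$ be any admissible boundary Lindbladians on $\Lambda_1,\Lambda_2$, let $b_Z$, $B_\alpha$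 ($\alpha\in J_Z$) be the terms of $\mathcal B_{\Lambda_1}$, let $\partial$ be the family of $Z\subset\Lambda$ with $\operatorname{diam}Z\le R$ that meet both $\Lambda_1$ and $\Lambda_2$, and set $$\mathcal L_\partial=\sum_{Z\in\partial}\big(-i[h_Z,\cdot]+\mathcal D_Z\big)-\mathcal B_{\Lambda_1}-\mathcal B_{\Lambda_2},$$ with norm $\|\mathcal L_\partial\|_\infty=\sup\{\|\mathcal L_\partial(a)\|: a\in\mathcal B(\ell^2(\Lambda)),\ \|a\|\le1\}$. For $\xi\in\{x,y\}$ consider on $\ell^2(\Lambda_\xi)$ $$D_{\Lambda_\xi}=-i\sum_{Z\subset\Lambda_\xi}\big(h_Z+1[Z\in\partial_{\Lambda_1}]b_Z\big)-\frac12\sum_{Z\subset\Lambda_\xi}\Big(\sum_{\alpha\in I_Z}L_\alpha^*L_\alpha+1[Z\in\partial_{\Lambda_1}]\sum_{\alpha\in J_Z}B_\alpha^*B_\alpha\Big),$$ and for $\varepsilon>0$, $u\in\Lambda_x$, $v\in\Lambda_y$ let $$k^\varepsilon_{x,y}(u,v)=\int_{\Gamma_\varepsilon}\langle\delta_x,(z-D_{\Lambda_x})^{-1}\delta_u\rangle\,\langle\delta_v,(\varepsilon-z-D_{\Lambda_y}^*)^{-1}\delta_y\rangle\,\frac{dz}{2\pi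 i},$$ where $\Gamma_\varepsilon$ is any bounded closed contour in $\{\operatorname{Re}z<\varepsilon\}\setminus\sigma(D_{\Lambda_x})$ winding once anticlockwise around $\sigma(D_{\Lambda_x})$. For a state $\rho$ (a non-negative trace-class operator on $\ell^2(\Lambda)$ with trace one) let $\mathcal A_\varepsilon(\rho)=\varepsilon\int_0^\infty e^{-t\varepsilon}e^{t\mathcal L}(\rho)\,dt$. (a) Let $r\ge R$ be an integer such that all $b_Z$ and all $B_\alpha$ ($\alpha\in J_Z$) are supported in $\{u:\mathrm{dist}(u,\Lambda_2)\le r\}$; thus $r=R$ if the boundary terms act only within distance $R$ of $\Lambda_2$ (in particular if $\mathcal B_{\Lambda_1}=0$), and $r=2R$ is always possible. Then for every state $\rho$, all $\varepsilon>0$ and every such contour, the integral $\mathcal A_\varepsilon(\rho)$ converges absolutely and $$\Big|\langle\delta_x,\mathcal A_\varepsilon(\rho)\delta_y\rangle-\varepsilon\sum_{u\in\Lambda_x,\,v\in\Lambda_y}k^\varepsilon_{x,y}(u,v)\langle\delta_u,\rho\,\delta_v\rangle\Big|\le\sum_{u\in\Lambda_x,\,v\in\Lambda_y}1[u\in\partial_r\Lambda_x\text{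 or }v\in\partial_r\Lambda_y]\,|k^\varepsilon_{x,y}(u,v)|\,\|\mathcal L_\partial\|_\infty .$$ (b) There is a constant $C<\infty$ depending only on $R$ and $d$ such that $$\|\mathcal L_\partial\|_\infty\le C\,N\,(1+IN)\,|\partial_R\Lambda_x|\,|\partial_R\Lambda_y| .$$ -/

import Mathlib

open scoped ComplexInnerProductSpace

noncomputable section

namespace OpenLattice

/-! ### Geometry -/

/-- The nearest-neighbour graph on `ℤ^d`: two sites are adjacent iff their `ℓ¹`-distance is `1`. -/
def latticeGraph (d : ℕ) : SimpleGraph (Fin d → ℤ) where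
  Adj a b := ∑ i, |a i - b i| = 1
  symm := ⟨fun a b h => by simpa only [abs_sub_comm] using h⟩
  loopless := ⟨fun a h => by simp at h⟩

variable {d : ℕ} {Λ : Set (Fin d → ℤ)}

/-- Graph distance inside `Λ`, regarded as an induced subgraph of `ℤ^d`
(it is `⊤` for two sites in different connected components of `Λ`). -/
def gdist (u v : Λ) : ℕ∞ := ((latticeGraph d).induce Λ).edist u v

/-- Diameter of `Z ⊆ Λ` for the graph distance of `Λ`. -/
def diam (Z : Set Λ) : ℕ∞ := ⨆ u ∈ Z, ⨆ v ∈ Z, gdist u v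

/-- Graph distance of `ℤ^d` between two sites of `Λ`. -/
def ambientDist (u v : Λ) : ℕ∞ := (latticeGraph d).edist (u : Fin d → ℤ) v

/-- Distance of two sets of sites for the distance `δ` of sites; it is `⊤` if one of them is
empty. -/
def setDist (δ : Λ → Λ → ℕ∞) (Z Z' : Set Λ) : ℕ∞ := ⨅ u ∈ Z, ⨅ v ∈ Z', δ u v

/-- The box `Λ_x = {u : d(x,u) ≤ d(x,y)/3}`; the box around `y` is `box y x`. -/
def box (x y : Λ) : Set Λ := {u | 3 * gdist x u ≤ gdist x y}

/-- The `r`-boundary of `S` within `Λ`. -/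
def rBoundary (δ : Λ → Λ → ℕ∞) (r : ℕ) (S : Set Λ) : Set Λ :=
  {u | max (setDist δ {u} S) (setDist δ {u} Sᶜ) ≤ r}

/-- The sets of diameter at most `R` that meet both `S` and its complement. -/
def crossing (R : ℕ) (S : Set Λ) : Set (Set Λ) :=
  {Z | diam Z ≤ R ∧ (S ∩ Z).Nonempty ∧ (Sᶜ ∩ Z).Nonempty}

/-- The sets of diameter at most `R` inside `S` at distance at most `R` from the complement. -/
def innerBoundary (δ : Λ → Λ → ℕ∞) (R : ℕ) (S : Set Λ) : Set (Set Λ) :=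
  {Z | Z ⊆ S ∧ diam Z ≤ R ∧ setDist δ Z Sᶜ ≤ R}

/-! ### Operators on `ℓ²(Λ)` -/

/-- The Hilbert space `ℓ²(Λ)`. -/
abbrev ell2 (Λ : Set (Fin d → ℤ)) : Type := lp (fun _ : Λ => ℂ) 2

/-- Bounded operators on `ℓ²(Λ)`; `star A` is the adjoint of `A`. -/
abbrev Op (Λ : Set (Fin d → ℤ)) : Type := ell2 Λ →L[ℂ] ell2 Λ

open Classical in
/-- The canonical basis vector at `u`. -/
def delta (u : Λ) : ell2 Λ := lp.single 2 u (1 : ℂ)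

/-- The support of an operator. -/
def opSupport (A : Op Λ) : Set Λ := {u | ∃ v, ⟪delta v, A (delta u)⟫ ≠ 0 ∨ ⟪delta u, A (delta v)⟫ ≠ 0}

/-- The sum of a family of operators in the weak operator topology. -/
def wotSum {ι : Type*} (T : ι → Op Λ) : Op Λ :=
  (∑' i, ContinuousLinearMapWOT.ofCLM (T i) : ell2 Λ →WOT[ℂ] ell2 Λ).toCLM

/-- States: positive operators of trace `1` (a positive operator is trace class iff its diagonal
in the canonical basis is summable, and the trace is the sum of the diagonal). -/
def IsState (ρ : Op Λ) : Prop := ρ.IsPositive ∧ HasSum (fun u => ⟪delta u, ρ (delta u)⟫) 1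

/-! ### Local Lindbladians -/

/-- The data of an `(R, I, N)`-local Lindbladian on `Λ`: Hamiltonian terms `h Z` and finitely many
Lindblad operators `jump Z α` for every `Z ⊆ Λ`. -/
structure LocalLindbladian (Λ : Set (Fin d → ℤ)) (R I : ℕ) (N : ℝ) where
  h : Set Λ → Op Λ
  numJump : Set Λ → ℕ
  jump : (Z : Set Λ) → Fin (numJump Z) → Op Λ
  h_selfAdjoint : ∀ Z, IsSelfAdjoint (h Z)
  h_support : ∀ Z, opSupport (h Z) ⊆ Z
  jump_support : ∀ Z α, opSupport (jump Z α) ⊆ Z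
  h_eq_zero : ∀ Z, (R : ℕ∞) < diam Z → h Z = 0
  jump_eq_zero : ∀ Z α, (R : ℕ∞) < diam Z → jump Z α = 0
  numJump_le : ∀ Z, numJump Z ≤ I
  h_norm : ∀ Z, ‖h Z‖ ≤ N
  jump_norm : ∀ Z α, ‖jump Z α‖ ≤ N

namespace LocalLindbladian

variable {R I : ℕ} {N : ℝ}

/-- The contribution of `Z`:
`ρ ↦ -i [h_Z, ρ] + ∑_α (L_α ρ L_α^* - (L_α^* L_α ρ + ρ L_α^* L_α) / 2)`. -/
def term (L : LocalLindbladian Λ R I N) (Z : Set Λ) (ρ : Op Λ) : Op Λ :=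
  -Complex.I • (L.h Z * ρ - ρ * L.h Z) +
    ∑ α, (L.jump Z α * ρ * star (L.jump Z α) - (1 / 2 : ℂ) •
      (star (L.jump Z α) * L.jump Z α * ρ + ρ * (star (L.jump Z α) * L.jump Z α)))

/-- The effective generator
`-i ∑_Z h_Z - (1/2) ∑_Z ∑_α L_α^* L_α` of the non-hermitian evolution. -/
def effective (L : LocalLindbladian Λ R I N) : Op Λ :=
  wotSum fun Z => -Complex.I • L.h Z - (1 / 2 : ℂ) • ∑ α, star (L.jump Z α) * L.jump Z α

open Classical in
/-- Keep only the terms belonging to the sets `Z ∈ P`. -/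
def restrict (L : LocalLindbladian Λ R I N) (P : Set (Set Λ)) : LocalLindbladian Λ R I N where
  h Z := if Z ∈ P then L.h Z else 0
  numJump := L.numJump
  jump Z α := if Z ∈ P then L.jump Z α else 0
  h_selfAdjoint Z := by
    split_ifs
    · exact L.h_selfAdjoint Z
    · exact IsSelfAdjoint.zero _
  h_support Z := by
    split_ifs
    · exact L.h_support Z
    · intro u hu; simp [opSupport] at hu
  jump_support Z α := by
    split_ifs
    · exact L.jump_support Z α
    · intro u hu; simp [opSupport] at hu
  h_eq_zero Z hZ := by simp [L.h_eq_zero Z hZ]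
  jump_eq_zero Z α hZ := by simp [L.jump_eq_zero Z α hZ]
  numJump_le := L.numJump_le
  h_norm Z := by
    split_ifs
    · exact L.h_norm Z
    · simpa using (norm_nonneg _).trans (L.h_norm Z)
  jump_norm Z α := by
    split_ifs
    · exact L.jump_norm Z α
    · simpa using (norm_nonneg _).trans (L.h_norm Z)

end LocalLindbladian

/-! ### The sum over all `Z` defines a bounded map -/

section Aux

variable {R I : ℕ} {N : ℝ}

theorem abs_sub_le_of_gdist {u v : Λ} (h : gdist u v ≤ R) (i : Fin d) :
    |(u : Fin d → ℤ) i - (v : Fin d → ℤ) i| ≤ R := by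
  have key : ∀ (a b : Λ) (p : ((latticeGraph d).induce Λ).Walk a b),
      |(a : Fin d → ℤ) i - (b : Fin d → ℤ) i| ≤ p.length := by
    intro a b p
    induction p with
    | nil => simp
    | @cons a b c hab p ih =>
      have h1 : ∑ j, |(a : Fin d → ℤ) j - (b : Fin d → ℤ) j| = 1 := hab
      have h2 : |(a : Fin d → ℤ) i - (b : Fin d → ℤ) i| ≤ 1 :=
        h1 ▸ Finset.single_le_sum (f := fun j => |(a : Fin d → ℤ) j - (b : Fin d → ℤ) j|)
          (fun j _ => abs_nonneg _) (Finset.mem_univ i)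
      have h3 := abs_sub_le ((a : Fin d → ℤ) i) ((b : Fin d → ℤ) i) ((c : Fin d → ℤ) i)
      rw [SimpleGraph.Walk.length_cons]
      push_cast
      linarith
  have hne : ((latticeGraph d).induce Λ).edist u v ≠ ⊤ := fun h' => by
    rw [gdist, h'] at h; exact absurd h (by simp)
  obtain ⟨p, hp⟩ := SimpleGraph.exists_walk_of_edist_ne_top hne
  have h4 : (p.length : ℕ∞) ≤ R := hp ▸ h
  have h5 : p.length ≤ R := by exact_mod_cast h4
  exact (key u v p).trans (by exact_mod_cast h5)

theorem exists_ball (R : ℕ) : ∃ M : ℕ, ∀ u : Λ, ∃ B : Finset Λ, B.card ≤ M ∧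
    ∀ v, gdist u v ≤ R → v ∈ B := by
  classical
  refine ⟨(2 * R + 1) ^ d, fun u => ?_⟩
  let B' : Finset (Fin d → ℤ) := Fintype.piFinset fun i =>
    Finset.Icc ((u : Fin d → ℤ) i - R) ((u : Fin d → ℤ) i + R)
  refine ⟨B'.preimage Subtype.val Subtype.val_injective.injOn, ?_, ?_⟩
  · have h1 : (B'.preimage (Subtype.val : Λ → _) Subtype.val_injective.injOn).card ≤ B'.card :=
      Finset.card_le_card_of_injOn Subtype.val (fun a ha => by simpa using ha)
        Subtype.val_injective.injOn
    refine h1.trans ?_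
    simp only [B', Fintype.card_piFinset, Int.card_Icc]
    refine (Finset.prod_le_pow_card _ _ (2 * R + 1) fun i _ => ?_).trans (by simp)
    omega
  · intro v hv
    simp only [Finset.mem_preimage, B', Fintype.mem_piFinset, Finset.mem_Icc]
    intro i
    have := abs_le.1 (abs_sub_le_of_gdist hv i)
    constructor <;> linarith [this.1, this.2]

theorem gdist_le_diam {Z : Set Λ} {u v : Λ} (hu : u ∈ Z) (hv : v ∈ Z) : gdist u v ≤ diam Z :=
  le_trans (le_iSup₂_of_le (f := fun v (_ : v ∈ Z) => gdist u v) v hv le_rfl)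
    (le_iSup₂_of_le (f := fun u (_ : u ∈ Z) => ⨆ v ∈ Z, gdist u v) u hu le_rfl)

theorem finite_of_diam {Z : Set Λ} (hZ : diam Z ≤ R) : Z.Finite := by
  rcases Z.eq_empty_or_nonempty with rfl | ⟨u, hu⟩
  · exact Set.finite_empty
  · obtain ⟨M, hM⟩ := exists_ball (Λ := Λ) R
    obtain ⟨B, -, hB⟩ := hM u
    exact B.finite_toSet.subset fun v hv => hB v ((gdist_le_diam hu hv).trans hZ)

/-- The `ℓ¹`-norm of the restriction of `φ` to `Z`, set to `0` if the diameter exceeds `R`. -/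
def locNorm (R : ℕ) (Z : Set Λ) (φ : ell2 Λ) : ℝ :=
  open Classical in if hZ : diam Z ≤ R then ∑ u ∈ (finite_of_diam hZ).toFinset, ‖φ u‖ else 0

theorem locNorm_nonneg (Z : Set Λ) (φ : ell2 Λ) : 0 ≤ locNorm R Z φ := by
  unfold locNorm
  split_ifs
  · exact Finset.sum_nonneg fun _ _ => norm_nonneg _
  · exact le_rfl

theorem sum_sq_le (φ : ell2 Λ) (s : Finset Λ) : ∑ u ∈ s, ‖φ u‖ ^ 2 ≤ ‖φ‖ ^ 2 := by
  have := lp.sum_rpow_le_norm_rpow (p := 2) (by norm_num) φ s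
  simpa using this

theorem exists_sum_locNorm_sq (R : ℕ) : ∃ K : ℝ, 0 ≤ K ∧ ∀ (φ : ell2 Λ) (F : Finset (Set Λ)),
    ∑ Z ∈ F, locNorm R Z φ ^ 2 ≤ K * ‖φ‖ ^ 2 := by
  classical
  obtain ⟨M, hM⟩ := exists_ball (Λ := Λ) R
  refine ⟨M * 2 ^ M, by positivity, fun φ F => ?_⟩
  have hdom : ∀ Z : Set Λ, ∃ s : Finset Λ, (∀ u ∈ s, u ∈ Z ∧ diam Z ≤ R) ∧
      locNorm R Z φ ^ 2 ≤ M * ∑ u ∈ s, ‖φ u‖ ^ 2 := by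
    intro Z
    by_cases hZ : diam Z ≤ R
    · refine ⟨(finite_of_diam hZ).toFinset, fun u hu => ⟨by simpa using hu, hZ⟩, ?_⟩
      rw [locNorm, dif_pos hZ]
      refine sq_sum_le_card_mul_sum_sq.trans ?_
      refine mul_le_mul_of_nonneg_right ?_ (Finset.sum_nonneg fun _ _ => by positivity)
      rcases Z.eq_empty_or_nonempty with rfl | ⟨u, hu⟩
      · simp
      · obtain ⟨B, hBM, hB⟩ := hM u
        have : (finite_of_diam hZ).toFinset ⊆ B := fun v hv =>
          hB v ((gdist_le_diam hu (by simpa using hv)).trans hZ)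
        exact_mod_cast (Finset.card_le_card this).trans hBM
    · exact ⟨∅, by simp, by simp [locNorm, hZ]⟩
  choose s hs hb using hdom
  calc ∑ Z ∈ F, locNorm R Z φ ^ 2 ≤ ∑ Z ∈ F, M * ∑ u ∈ s Z, ‖φ u‖ ^ 2 :=
        Finset.sum_le_sum fun Z _ => hb Z
    _ = M * ∑ Z ∈ F, ∑ u ∈ s Z, ‖φ u‖ ^ 2 := by rw [Finset.mul_sum]
    _ = M * ∑ u ∈ F.biUnion s, ∑ Z ∈ F with u ∈ s Z, ‖φ u‖ ^ 2 := by
        congr 1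
        refine Finset.sum_comm' fun Z u => ?_
        simp only [Finset.mem_filter, Finset.mem_biUnion]
        exact ⟨fun h => ⟨h, Z, h⟩, fun h => h.1⟩
    _ ≤ M * ∑ u ∈ F.biUnion s, 2 ^ M * ‖φ u‖ ^ 2 := by
        refine mul_le_mul_of_nonneg_left (Finset.sum_le_sum fun u _ => ?_) (by positivity)
        rw [Finset.sum_const, nsmul_eq_mul]
        refine mul_le_mul_of_nonneg_right ?_ (by positivity)
        obtain ⟨B, hBM, hB⟩ := hM u
        have h1 : (F.filter fun Z => u ∈ s Z).card ≤ B.powerset.card := by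
          refine Finset.card_le_card_of_injOn (fun Z => B.filter fun v => v ∈ Z)
            (fun Z _ => Finset.mem_coe.2 (Finset.mem_powerset.2 fun v hv => (Finset.mem_filter.1 hv).1))
            fun Z hZ Z' hZ' h => ?_
          have hsub : ∀ W : Set Λ, u ∈ s W → ∀ v ∈ W, v ∈ B := fun W hW v hv =>
            hB v ((gdist_le_diam (hs W u hW).1 hv).trans (hs W u hW).2)
          simp only [Finset.coe_filter, Set.mem_ofPred_eq] at hZ hZ'
          ext v
          have hv := Finset.ext_iff.1 h v
          simp only [Finset.mem_filter] at hv
          exact ⟨fun h' => (hv.1 ⟨hsub Z hZ.2 v h', h'⟩).2,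
            fun h' => (hv.2 ⟨hsub Z' hZ'.2 v h', h'⟩).2⟩
        rw [Finset.card_powerset] at h1
        exact_mod_cast h1.trans (Nat.pow_le_pow_right (by norm_num) hBM)
    _ = M * 2 ^ M * ∑ u ∈ F.biUnion s, ‖φ u‖ ^ 2 := by rw [← Finset.mul_sum, mul_assoc]
    _ ≤ M * 2 ^ M * ‖φ‖ ^ 2 := mul_le_mul_of_nonneg_left (sum_sq_le φ _) (by positivity)

theorem exists_sum_locNorm_mul (R : ℕ) : ∃ K : ℝ, 0 ≤ K ∧
    ∀ (φ ψ : ell2 Λ) (F : Finset (Set Λ)),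
      ∑ Z ∈ F, locNorm R Z φ * locNorm R Z ψ ≤ K * (‖φ‖ * ‖ψ‖) := by
  obtain ⟨K, hK, h⟩ := exists_sum_locNorm_sq (Λ := Λ) R
  refine ⟨K, hK, fun φ ψ F => ?_⟩
  refine abs_le_of_sq_le_sq' ?_ (by positivity) |>.2
  refine (Finset.sum_mul_sq_le_sq_mul_sq F _ _).trans ?_
  refine (mul_le_mul (h φ F) (h ψ F) (Finset.sum_nonneg fun _ _ => by positivity)
    (by positivity)).trans (le_of_eq (by ring))

theorem inner_delta (u : Λ) (φ : ell2 Λ) : ⟪delta u, φ⟫ = φ u := by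
  classical
  have := lp.inner_single_left (𝕜 := ℂ) (G := fun _ : Λ => ℂ) u 1 φ
  rw [delta]
  convert this using 1
  simp

theorem norm_delta (u : Λ) : ‖delta u‖ = 1 := by
  rw [delta, lp.norm_single (by norm_num)]; simp

theorem apply_delta_eq_zero {A : Op Λ} {Z : Set Λ} (hA : opSupport A ⊆ Z) {u : Λ} (hu : u ∉ Z) :
    A (delta u) = 0 := by
  ext v
  rw [← inner_delta]
  by_contra h
  exact hu (hA ⟨v, Or.inl h⟩)

theorem inner_star (A : Op Λ) (f g : ell2 Λ) : ⟪f, star A g⟫ = ⟪A f, g⟫ := by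
  rw [ContinuousLinearMap.star_eq_adjoint, ContinuousLinearMap.adjoint_inner_right]

theorem opSupport_star_subset (A : Op Λ) : opSupport (star A) ⊆ opSupport A := by
  rintro u ⟨v, h⟩
  refine ⟨v, ?_⟩
  rw [inner_star, inner_star] at h
  rcases h with h | h
  · right
    intro h'
    exact h (by rw [← inner_conj_symm, h', map_zero])
  · left
    intro h'
    exact h (by rw [← inner_conj_symm, h', map_zero])

theorem norm_apply_le_locNorm {A : Op Λ} {Z : Set Λ} (hA : opSupport A ⊆ Z)
    (h0 : (R : ℕ∞) < diam Z → A = 0) (φ : ell2 Λ) : ‖A φ‖ ≤ ‖A‖ * locNorm R Z φ := by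
  classical
  by_cases hZ : diam Z ≤ R
  · rw [locNorm, dif_pos hZ]
    have h1 : HasSum (fun u => φ u • A (delta u)) (A φ) := by
      have := A.hasSum (lp.hasSum_single (p := 2) (by norm_num) φ)
      refine this.congr_fun fun u => ?_
      rw [← map_smul]
      congr 1
      rw [delta, ← lp.single_smul, smul_eq_mul, mul_one]
    have h2 : HasSum (fun u => φ u • A (delta u))
        (∑ u ∈ (finite_of_diam hZ).toFinset, φ u • A (delta u)) :=
      hasSum_sum_of_ne_finset_zero fun u hu => by
        rw [apply_delta_eq_zero hA (by simpa using hu), smul_zero]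
    rw [h1.unique h2, Finset.mul_sum]
    refine (norm_sum_le _ _).trans (Finset.sum_le_sum fun u _ => ?_)
    rw [norm_smul, mul_comm]
    refine mul_le_mul_of_nonneg_right ?_ (norm_nonneg _)
    simpa [norm_delta] using A.le_opNorm (delta u)
  · simp [h0 (not_le.1 hZ), locNorm, hZ]

theorem norm_inner_le_locNorm {A : Op Λ} {Z : Set Λ} (hA : opSupport A ⊆ Z)
    (h0 : (R : ℕ∞) < diam Z → A = 0) (φ ψ : ell2 Λ) :
    ‖⟪φ, A ψ⟫‖ ≤ ‖A‖ * (locNorm R Z φ * locNorm R Z ψ) := by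
  classical
  by_cases hZ : diam Z ≤ R
  · let s := (finite_of_diam hZ).toFinset
    have hAψ : ∀ v, v ∉ s → (A ψ) v = 0 := by
      intro v hv
      rw [← inner_delta, ← ContinuousLinearMap.adjoint_inner_left,
        ← ContinuousLinearMap.star_eq_adjoint,
        apply_delta_eq_zero (Z := Z) ((opSupport_star_subset A).trans hA) (by simpa [s] using hv),
        inner_zero_left]
    have h1 : ⟪φ, A ψ⟫ = ∑ v ∈ s, ⟪φ v, (A ψ) v⟫ := by
      rw [lp.inner_eq_tsum, tsum_eq_sum]
      intro v hv
      rw [hAψ v hv, inner_zero_right]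
    have h2 : locNorm R Z φ = ∑ v ∈ s, ‖φ v‖ := by rw [locNorm, dif_pos hZ]
    rw [h1, h2, Finset.sum_mul, Finset.mul_sum]
    refine (norm_sum_le _ _).trans (Finset.sum_le_sum fun v _ => ?_)
    refine (norm_inner_le_norm _ _).trans ?_
    have h3 := (lp.norm_apply_le_norm (by norm_num) (A ψ) v).trans (norm_apply_le_locNorm hA h0 ψ)
    calc ‖φ v‖ * ‖(A ψ) v‖ ≤ ‖φ v‖ * (‖A‖ * locNorm R Z ψ) := by gcongr
      _ = _ := by ring
  · simp [h0 (not_le.1 hZ), locNorm, hZ]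

theorem norm_inner_term_le (L : LocalLindbladian Λ R I N) (Z : Set Λ) (ρ : Op Λ) (φ ψ : ell2 Λ) :
    ‖⟪φ, L.term Z ρ ψ⟫‖ ≤ (N + I * N ^ 2) * (locNorm R Z φ * locNorm R Z (ρ ψ) +
      locNorm R Z (star ρ φ) * locNorm R Z ψ + ‖ρ‖ * (locNorm R Z φ * locNorm R Z ψ)) := by
  have hN : 0 ≤ N := (norm_nonneg _).trans (L.h_norm Z)
  have w0 := locNorm_nonneg (R := R) Z φ
  have w1 := locNorm_nonneg (R := R) Z ψ
  have w2 := locNorm_nonneg (R := R) Z (ρ ψ)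
  have w3 := locNorm_nonneg (R := R) Z (star ρ φ)
  set a := locNorm R Z φ
  set b := locNorm R Z ψ
  set a' := locNorm R Z (star ρ φ)
  set b' := locNorm R Z (ρ ψ)
  have adj : ∀ (A : Op Λ) (f g : ell2 Λ), ⟪f, A g⟫ = ⟪star A f, g⟫ := fun A f g => by
    rw [ContinuousLinearMap.star_eq_adjoint, ContinuousLinearMap.adjoint_inner_left]
  have hh : ∀ f g : ell2 Λ, ‖⟪f, L.h Z g⟫‖ ≤ N * (locNorm R Z f * locNorm R Z g) := fun f g =>
    (norm_inner_le_locNorm (L.h_support Z) (L.h_eq_zero Z) f g).trans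
      (mul_le_mul_of_nonneg_right (L.h_norm Z)
        (mul_nonneg (locNorm_nonneg _ _) (locNorm_nonneg _ _)))
  have hj : ∀ α (f : ell2 Λ), ‖L.jump Z α f‖ ≤ N * locNorm R Z f := fun α f =>
    (norm_apply_le_locNorm (L.jump_support Z α) (L.jump_eq_zero Z α) f).trans
      (mul_le_mul_of_nonneg_right (L.jump_norm Z α) (locNorm_nonneg _ _))
  have hj' : ∀ α (f : ell2 Λ), ‖star (L.jump Z α) f‖ ≤ N * locNorm R Z f := fun α f =>
    (norm_apply_le_locNorm ((opSupport_star_subset _).trans (L.jump_support Z α))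
      (fun h => by rw [L.jump_eq_zero Z α h, star_zero]) f).trans
      (mul_le_mul_of_nonneg_right ((norm_star _).trans_le (L.jump_norm Z α))
        (locNorm_nonneg _ _))
  have e1 : ‖⟪φ, (-Complex.I • (L.h Z * ρ - ρ * L.h Z)) ψ⟫‖ ≤ N * (a * b') + N * (a' * b) := by
    simp only [smul_apply, sub_apply,
      mul_apply_eq_comp, inner_smul_right, inner_sub_right, norm_mul, norm_neg,
      Complex.norm_I, one_mul]
    refine (norm_sub_le _ _).trans (add_le_add (hh _ _) ?_)
    rw [adj ρ]
    exact hh _ _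
  have e2 : ∀ α, ‖⟪φ, (L.jump Z α * ρ * star (L.jump Z α) - (1 / 2 : ℂ) •
      (star (L.jump Z α) * L.jump Z α * ρ + ρ * (star (L.jump Z α) * L.jump Z α))) ψ⟫‖ ≤
      N ^ 2 * (a * b' + a' * b + ‖ρ‖ * (a * b)) := by
    intro α
    simp only [smul_apply, sub_apply,
      add_apply, mul_apply_eq_comp, inner_smul_right,
      inner_sub_right, inner_add_right]
    have t1 : ‖⟪φ, L.jump Z α (ρ (star (L.jump Z α) ψ))⟫‖ ≤ N ^ 2 * (‖ρ‖ * (a * b)) := by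
      rw [adj]
      refine (norm_inner_le_norm _ _).trans ?_
      calc _ ≤ (N * a) * (‖ρ‖ * (N * b)) := by
            refine mul_le_mul (hj' α φ) ((ρ.le_opNorm _).trans ?_) (norm_nonneg _) (by positivity)
            exact mul_le_mul_of_nonneg_left (hj' α ψ) (norm_nonneg _)
        _ = _ := by ring
    have tt : ∀ f g : ell2 Λ, ‖⟪f, star (L.jump Z α) (L.jump Z α g)⟫‖ ≤
        N ^ 2 * (locNorm R Z f * locNorm R Z g) := fun f g => by
      rw [adj, star_star]
      refine (norm_inner_le_norm _ _).trans ((mul_le_mul (hj α f) (hj α g) (norm_nonneg _)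
        (mul_nonneg hN (locNorm_nonneg _ _))).trans (le_of_eq (by ring)))
    have t2 := tt φ (ρ ψ)
    have t3 : ‖⟪φ, ρ (star (L.jump Z α) (L.jump Z α ψ))⟫‖ ≤ N ^ 2 * (a' * b) := by
      rw [adj ρ]; exact tt _ _
    refine (norm_sub_le _ _).trans ?_
    rw [norm_mul]
    have t4 := norm_add_le ⟪φ, star (L.jump Z α) (L.jump Z α (ρ ψ))⟫
      ⟪φ, ρ (star (L.jump Z α) (L.jump Z α ψ))⟫
    have t5 : ‖(1 / 2 : ℂ)‖ = 1 / 2 := by norm_num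
    rw [t5]
    have p1 : 0 ≤ N ^ 2 * (a * b') := by positivity
    have p2 : 0 ≤ N ^ 2 * (a' * b) := by positivity
    linarith
  rw [LocalLindbladian.term, add_apply, inner_add_right,
    sum_apply, inner_sum]
  refine (norm_add_le _ _).trans ?_
  have e3 := (norm_sum_le Finset.univ fun α => ⟪φ, (L.jump Z α * ρ * star (L.jump Z α) -
      (1 / 2 : ℂ) • (star (L.jump Z α) * L.jump Z α * ρ +
        ρ * (star (L.jump Z α) * L.jump Z α))) ψ⟫).trans (Finset.sum_le_sum fun α _ => e2 α)
  rw [Finset.sum_const, Finset.card_univ, Fintype.card_fin, nsmul_eq_mul] at e3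
  set c := a * b' + a' * b + ‖ρ‖ * (a * b)
  have hc : 0 ≤ c := by positivity
  have e4 : (L.numJump Z : ℝ) * (N ^ 2 * c) ≤ I * (N ^ 2 * c) :=
    mul_le_mul_of_nonneg_right (by exact_mod_cast L.numJump_le Z) (by positivity)
  have e5 : 0 ≤ N * (‖ρ‖ * (a * b)) := by positivity
  calc _ ≤ (N * (a * b') + N * (a' * b)) + I * (N ^ 2 * c) := add_le_add e1 (e3.trans e4)
    _ ≤ (N * (a * b') + N * (a' * b)) + N * (‖ρ‖ * (a * b)) + I * (N ^ 2 * c) := by linarith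
    _ = (N + I * N ^ 2) * c := by simp only [c]; ring

theorem exists_sum_inner_term (L : LocalLindbladian Λ R I N) : ∃ C : ℝ, 0 ≤ C ∧
    ∀ (ρ : Op Λ) (φ ψ : ell2 Λ) (F : Finset (Set Λ)),
      ∑ Z ∈ F, ‖⟪φ, L.term Z ρ ψ⟫‖ ≤ C * ‖ρ‖ * ‖φ‖ * ‖ψ‖ := by
  obtain ⟨K, hK, h⟩ := exists_sum_locNorm_mul (Λ := Λ) R
  have hN : 0 ≤ N := (norm_nonneg _).trans (L.h_norm ∅)
  refine ⟨(N + I * N ^ 2) * (3 * K), by positivity, fun ρ φ ψ F => ?_⟩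
  refine (Finset.sum_le_sum fun Z _ => norm_inner_term_le L Z ρ φ ψ).trans ?_
  rw [← Finset.mul_sum, Finset.sum_add_distrib, Finset.sum_add_distrib, ← Finset.mul_sum]
  have h1 := h φ (ρ ψ) F
  have h2 := h (star ρ φ) ψ F
  have h3 := mul_le_mul_of_nonneg_left (h φ ψ F) (norm_nonneg ρ)
  have h4 : ‖ρ ψ‖ ≤ ‖ρ‖ * ‖ψ‖ := ρ.le_opNorm ψ
  have h5 : ‖star ρ φ‖ ≤ ‖ρ‖ * ‖φ‖ := 
    ((star ρ).le_opNorm φ).trans_eq (congrArg (· * ‖φ‖) (norm_star ρ))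
  have h6 : K * (‖φ‖ * ‖ρ ψ‖) ≤ K * (‖φ‖ * (‖ρ‖ * ‖ψ‖)) := by gcongr
  have h7 : K * (‖star ρ φ‖ * ‖ψ‖) ≤ K * (‖ρ‖ * ‖φ‖ * ‖ψ‖) := by gcongr
  calc _ ≤ (N + I * N ^ 2) * (3 * K * (‖ρ‖ * ‖φ‖ * ‖ψ‖)) := by
        refine mul_le_mul_of_nonneg_left ?_ (by positivity)
        nlinarith
    _ = _ := by ring

/-- Weak convergence of a family of operators whose matrix elements are absolutely summable with a
uniform bound. -/
theorem hasSum_wot {ι : Type*} {T : ι → Op Λ} {C : ℝ} (hC : 0 ≤ C)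
    (hT : ∀ (φ ψ : ell2 Λ) (F : Finset ι), ∑ i ∈ F, ‖⟪φ, T i ψ⟫‖ ≤ C * ‖φ‖ * ‖ψ‖) :
    HasSum (fun i => ContinuousLinearMapWOT.ofCLM (T i))
      (ContinuousLinearMapWOT.ofCLM (wotSum T)) ∧ ‖wotSum T‖ ≤ C := by
  have hsn : ∀ φ ψ : ell2 Λ, Summable fun i => ‖⟪φ, T i ψ⟫‖ := fun φ ψ =>
    summable_of_sum_le (fun _ => norm_nonneg _) (hT φ ψ)
  have hs : ∀ φ ψ : ell2 Λ, Summable fun i => ⟪φ, T i ψ⟫ := fun φ ψ => (hsn φ ψ).of_norm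
  have hb : ∀ φ ψ : ell2 Λ, ‖∑' i, ⟪φ, T i ψ⟫‖ ≤ C * ‖φ‖ * ‖ψ‖ := fun φ ψ =>
    (norm_tsum_le_tsum_norm (hsn φ ψ)).trans ((hsn φ ψ).tsum_le_of_sum_le (hT φ ψ))
  let B : ell2 Λ →L⋆[ℂ] ell2 Λ →L[ℂ] ℂ := LinearMap.mkContinuous₂
    (LinearMap.mk₂'ₛₗ (starRingEnd ℂ) (RingHom.id ℂ) (fun φ ψ => ∑' i, ⟪φ, T i ψ⟫)
      (fun a b c => by simp only [inner_add_left]; exact Summable.tsum_add (hs a c) (hs b c))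
      (fun a b c => by simp only [inner_smul_left, tsum_mul_left, smul_eq_mul])
      (fun a b c => by
        simp only [map_add, inner_add_right]; exact Summable.tsum_add (hs a b) (hs a c))
      (fun a b c => by
        simp only [map_smul, inner_smul_right, tsum_mul_left, smul_eq_mul, RingHom.id_apply]))
    C (fun φ ψ => hb φ ψ)
  let A : Op Λ := star (InnerProductSpace.continuousLinearMapOfBilin B)
  have hA : ∀ φ ψ : ell2 Λ, ⟪φ, A ψ⟫ = ∑' i, ⟪φ, T i ψ⟫ := fun φ ψ => by
    rw [inner_star, InnerProductSpace.continuousLinearMapOfBilin_apply]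
    rfl
  have hsum : HasSum (fun i => ContinuousLinearMapWOT.ofCLM (T i))
      (ContinuousLinearMapWOT.ofCLM A) := by
    refine ContinuousLinearMapWOT.tendsto_iff_forall_inner_apply_tendsto.2 fun ψ φ => ?_
    have := (hs φ ψ).hasSum
    rw [← hA] at this
    refine Filter.Tendsto.congr (fun F => ?_) this
    have h1 : (∑ i ∈ F, ContinuousLinearMapWOT.ofCLM (T i) : ell2 Λ →WOT[ℂ] ell2 Λ) =
        ContinuousLinearMapWOT.ofCLM (∑ i ∈ F, T i) :=
      (map_sum (ContinuousLinearMapWOT.addEquiv (σ := RingHom.id ℂ) (E := ell2 Λ)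
        (F := ell2 Λ)).symm T F).symm
    rw [h1, ContinuousLinearMapWOT.ofCLM_apply, sum_apply, inner_sum]
  have heq : wotSum T = A := by rw [wotSum, hsum.tsum_eq]
  rw [heq]
  refine ⟨hsum, A.opNorm_le_bound hC fun ψ => ?_⟩
  by_cases h0 : A ψ = 0
  · rw [h0, norm_zero]; positivity
  · have h1 : ‖A ψ‖ * ‖A ψ‖ ≤ C * ‖A ψ‖ * ‖ψ‖ := by
      have h3 := hb (A ψ) ψ
      rw [← hA] at h3
      refine le_trans (le_of_eq ?_) h3
      rw [inner_self_eq_norm_sq_to_K]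
      simp [sq]
    have h2 : 0 < ‖A ψ‖ := norm_pos_iff.2 h0
    nlinarith

end Aux

namespace LocalLindbladian

variable {R I : ℕ} {N : ℝ}

theorem hasSum_term (L : LocalLindbladian Λ R I N) : ∃ C : ℝ, ∀ ρ : Op Λ,
    HasSum (fun Z => ContinuousLinearMapWOT.ofCLM (L.term Z ρ))
      (ContinuousLinearMapWOT.ofCLM (wotSum fun Z => L.term Z ρ)) ∧
    ‖wotSum fun Z => L.term Z ρ‖ ≤ C * ‖ρ‖ := by
  obtain ⟨C, hC, h⟩ := exists_sum_inner_term L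
  exact ⟨C, fun ρ => hasSum_wot (by positivity) (h ρ)⟩

/-- The Lindbladian `ρ ↦ ∑_Z (-i [h_Z, ρ] + 𝒟_Z(ρ))`, as a bounded map on the bounded operators. -/
def lindbladian (L : LocalLindbladian Λ R I N) : Op Λ →L[ℂ] Op Λ :=
  LinearMap.mkContinuousOfExistsBound
    { toFun := fun ρ => wotSum fun Z => L.term Z ρ
      map_add' := fun ρ σ => by
        obtain ⟨C, h⟩ := L.hasSum_term
        have h1 := (h ρ).1.add (h σ).1
        have h2 : ∀ Z, L.term Z (ρ + σ) = L.term Z ρ + L.term Z σ := fun Z => by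
          simp only [term, mul_add, add_mul, smul_add, smul_sub, Finset.sum_sub_distrib,
            Finset.sum_add_distrib]
          abel
        have h3 : wotSum (fun Z => L.term Z (ρ + σ)) =
          (ContinuousLinearMapWOT.ofCLM (wotSum fun Z => L.term Z ρ) +
            ContinuousLinearMapWOT.ofCLM (wotSum fun Z => L.term Z σ)).toCLM := by
          rw [← h1.tsum_eq, wotSum]
          simp only [h2, ContinuousLinearMapWOT.ofCLM_add]
        exact h3
      map_smul' := fun c ρ => by
        obtain ⟨C, h⟩ := L.hasSum_term
        have h1 := (h ρ).1.const_smul c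
        have h2 : ∀ Z, L.term Z (c • ρ) = c • L.term Z ρ := fun Z => by
          simp only [term, mul_smul_comm, smul_mul_assoc, smul_add, smul_sub,
            Finset.sum_sub_distrib, Finset.smul_sum, smul_comm c]
        have h3 : wotSum (fun Z => L.term Z (c • ρ)) =
          (c • ContinuousLinearMapWOT.ofCLM (wotSum fun Z => L.term Z ρ)).toCLM := by
          rw [← h1.tsum_eq, wotSum]
          simp only [h2, ContinuousLinearMapWOT.ofCLM_smul]
        exact h3 }
    (L.hasSum_term.imp fun _ h ρ => (h ρ).2)

end LocalLindbladian

set_option maxSynthPendingDepth 5 in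
instance : IsTopologicalRing (Op Λ →L[ℂ] Op Λ) := inferInstance

namespace LocalLindbladian

variable {R I : ℕ} {N : ℝ}

/-- The quantum dynamical semigroup `e^{tℒ}`, as the exponential series of the bounded map `ℒ` on
bounded operators. The trace-class operators embed continuously, `ℒ` is bounded for the trace norm
too, so on a trace-class operator the series is the same as the one formed in the trace class. -/
def evolution (L : LocalLindbladian Λ R I N) (t : ℝ) : Op Λ →L[ℂ] Op Λ :=
  NormedSpace.exp ((t : ℂ) • L.lindbladian)

/-- The Abel average `𝒜_ε(ρ) = ε ∫_0^∞ e^{-tε} e^{tℒ}(ρ) dt`. -/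
def abelAverage (L : LocalLindbladian Λ R I N) (ε : ℝ) (ρ : Op Λ) : Op Λ :=
  (ε : ℂ) • ∫ t in Set.Ioi (0 : ℝ), (Real.exp (-t * ε) : ℂ) • L.evolution t ρ

/-- `B` is an admissible boundary Lindbladian on `S`: all its terms belong to sets in the inner
boundary of `S`. -/
def IsBoundary (B : LocalLindbladian Λ R I N) (δ : Λ → Λ → ℕ∞) (S : Set Λ) : Prop :=
  ∀ Z ∉ innerBoundary δ R S, B.h Z = 0 ∧ ∀ α, B.jump Z α = 0

/-- All terms of `B` act on sites at distance at most `r` from the complement of `S`. -/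
def ActsWithin (B : LocalLindbladian Λ R I N) (δ : Λ → Λ → ℕ∞) (S : Set Λ) (r : ℕ) : Prop :=
  ∀ Z, ∀ u ∈ opSupport (B.h Z) ∪ ⋃ α, opSupport (B.jump Z α), setDist δ {u} Sᶜ ≤ r

/-- The boundary operator `ℒ_∂` for the decomposition `Λ = S ⊎ Sᶜ` and boundary Lindbladians
`B₁` on `S` and `B₂` on `Sᶜ`. -/
def boundaryOp (L B₁ B₂ : LocalLindbladian Λ R I N) (S : Set Λ) : Op Λ →L[ℂ] Op Λ :=
  (L.restrict (crossing R S)).lindbladian - B₁.lindbladian - B₂.lindbladian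

end LocalLindbladian

/-! ### The kernel -/

/-- `ℓ²(S)`, as the closed subspace of `ℓ²(Λ)` of the functions vanishing outside `S`. -/
def ell2On (S : Set Λ) : Submodule ℂ (ell2 Λ) where
  carrier := {φ | ∀ u ∉ S, φ u = 0}
  add_mem' ha hb u hu := by simp [ha u hu, hb u hu]
  zero_mem' u _ := by simp
  smul_mem' c φ h u hu := by simp [h u hu]

theorem isClosed_ell2On (S : Set Λ) : IsClosed (ell2On S : Set (ell2 Λ)) := by
  have : (ell2On S : Set (ell2 Λ)) = ⋂ u ∈ Sᶜ, {φ | ⟪delta u, φ⟫ = 0} := by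
    ext φ
    simp [ell2On, inner_delta]
  rw [this]
  exact isClosed_biInter fun u _ => isClosed_eq (by fun_prop) continuous_const

instance (S : Set Λ) : CompleteSpace (ell2On S) := (isClosed_ell2On S).completeSpace_coe

theorem delta_mem (S : Set Λ) (u : S) : delta (u : Λ) ∈ ell2On S := by
  intro v hv
  rw [delta, lp.single_apply_ne]
  rintro rfl
  exact hv u.2

/-- The canonical basis vector of `ℓ²(S)` at `u ∈ S`. -/
def deltaOn (S : Set Λ) (u : S) : ell2On S := ⟨delta (u : Λ), delta_mem S u⟩

/-- The compression of an operator on `ℓ²(Λ)` to `ℓ²(S)`. -/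
def compress (S : Set Λ) (A : Op Λ) : ell2On S →L[ℂ] ell2On S :=
  (ell2On S).orthogonalProjectionOnto ∘L A ∘L (ell2On S).subtypeL

theorem mem_box_self (x y : Λ) : x ∈ box x y := by
  change 3 * ((latticeGraph d).induce Λ).edist x x ≤ _
  simp

/-- The sites of `Λ₁ = Λ_x ⊎ Λ_y`. -/
def twoBoxes (x y : Λ) : Set Λ := box x y ∪ box y x

variable {R I : ℕ} {N : ℝ}

/-- The operator `D_S` on `ℓ²(S)` (for `S = Λ_x` or `S = Λ_y`, a part of `Λ₁`), with boundary terms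
given by `B`. -/
def dissipativeGen (L B : LocalLindbladian Λ R I N) (δ : Λ → Λ → ℕ∞) (Λ₁ S : Set Λ) :
    ell2On S →L[ℂ] ell2On S :=
  compress S ((L.restrict {Z | Z ⊆ S}).effective +
    (B.restrict {Z | Z ⊆ S ∧ Z ∈ innerBoundary δ R Λ₁}).effective)

/-- `γ : [0,1] → ℂ` is a closed rectifiable curve, differentiable up to finitely many parameters
with integrable derivative (for instance any closed piecewise continuously differentiable
curve), which lies in `U` and avoids `K` and which winds once anticlockwise around every point
of `K`. -/
structure IsContour (γ : ℝ → ℂ) (U K : Set ℂ) : Prop where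
  continuousOn : ContinuousOn γ (Set.Icc 0 1)
  closed : γ 0 = γ 1
  differentiable : ∃ s : Finset ℝ, ∀ t ∈ Set.Ioo (0 : ℝ) 1, t ∉ s → DifferentiableAt ℝ γ t
  integrable : IntervalIntegrable (deriv γ) MeasureTheory.volume 0 1
  subset : ∀ t ∈ Set.Icc (0 : ℝ) 1, γ t ∈ U \ K
  winding : ∀ w ∈ K, (2 * Real.pi * Complex.I)⁻¹ * ∫ t in (0 : ℝ)..1, deriv γ t / (γ t - w) = 1

/-- The kernel `k^ε_{x,y}(u,v)`, with the integral over the contour `γ`. -/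
def kernel (L B : LocalLindbladian Λ R I N) (δ : Λ → Λ → ℕ∞) (x y : Λ) (ε : ℝ)
    (γ : ℝ → ℂ) (u : box x y) (v : box y x) : ℂ :=
  (2 * Real.pi * Complex.I)⁻¹ * ∫ t in (0 : ℝ)..1,
    ⟪deltaOn (box x y) ⟨x, mem_box_self x y⟩,
      resolvent (dissipativeGen L B δ (twoBoxes x y) (box x y)) (γ t) (deltaOn (box x y) u)⟫ *
    ⟪deltaOn (box y x) v,
      resolvent (star (dissipativeGen L B δ (twoBoxes x y) (box y x))) ((ε : ℂ) - γ t)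
        (deltaOn (box y x) ⟨y, mem_box_self y x⟩)⟫ *
    deriv γ t

end OpenLattice

end

open OpenLattice

open scoped ComplexInnerProductSpace ComplexOrder

namespace OpenLattice

variable {d : ℕ} {Λ : Set (Fin d → ℤ)} {R I : ℕ} {N : ℝ}

/-! ### Matrix elements of weak sums -/

/-! Put `G_Z = -i h_Z - (1/2) ∑ L_α^* L_α`, so that the contribution of `Z` is `ρ ↦ G_Z ρ + ρ G_Z^*
+ ∑ L_α ρ L_α^*`. The Abel average `σ` of a state `ρ` satisfies `ε σ - ℒ σ = ε ρ` and `‖σ‖ ≤ 1`,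
provided the orbit `e^{tℒ} ρ` stays bounded. Boundedness holds because the semigroup preserves
positivity and does not increase the trace, and the trace of a positive operator dominates its norm
(`traceLE_evolution`, `TraceLE.norm_le`, `abelAverage_equation`).

The boxes `Λ_x` and `Λ_y` are more than `R` apart, so no term touches both. In the block of `ℒ σ`
from `ℓ²(Λ_y)` to `ℓ²(Λ_x)` the sandwich terms of sets inside a box therefore vanish: a set in `Λ_x`
acts by left multiplication with `G_Z` only, a set in `Λ_y` by right multiplication with `G_Z^*`
only. Adding and subtracting the boundary Lindbladians, the block `W` of `σ` solves the Sylvester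
equation `ε W - D_x W - W D_y^* = Y`, where `Y` is the block of `ε ρ + ℒ_∂ σ`
(`inner_lindbladian_eq`).

Since `Y = (z - D_x) W + W (ε - z - D_y^*)` for every `z`, multiplying by the two resolvents and
integrating over the contour gives `2πi W`: the resolvent of `D_x` integrates to `2πi`, and that of
`D_y^*` to zero, because `D_y` is dissipative while `Re (ε - z) > 0` (`integral_sylvester`).
Expanding `Y` in the canonical bases produces the kernel (`inner_eq_sum_kernel`). The part `ε ρ` is
the main term; the part `ℒ_∂ σ` is the error. Its entries are at most `‖ℒ_∂‖` and vanish when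
neither site is in the `r`-boundary of its box (`inner_boundaryOp_eq_zero`).

For the norm of `ℒ_∂`, only sets of diameter at most `R` meeting the two `R`-boundaries contribute.
There are boundedly many per site, and the sum of the two boundary sizes is at most twice their
product (`norm_boundaryOp_le`). -/

theorem hasSum_inner_of_wot {ι : Type*} {T : ι → Op Λ} {A : Op Λ}
    (h : HasSum (fun i => ContinuousLinearMapWOT.ofCLM (T i)) (ContinuousLinearMapWOT.ofCLM A))
    (φ ψ : ell2 Λ) : HasSum (fun i => ⟪φ, T i ψ⟫) ⟪φ, A ψ⟫ := by
  have h2 := ContinuousLinearMapWOT.tendsto_iff_forall_inner_apply_tendsto.1 h ψ φ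
  refine Filter.Tendsto.congr (fun F => ?_) h2
  have h1 : (∑ i ∈ F, ContinuousLinearMapWOT.ofCLM (T i) : ell2 Λ →WOT[ℂ] ell2 Λ) =
      ContinuousLinearMapWOT.ofCLM (∑ i ∈ F, T i) :=
    (map_sum (ContinuousLinearMapWOT.addEquiv (σ := RingHom.id ℂ) (E := ell2 Λ)
      (F := ell2 Λ)).symm T F).symm
  rw [h1, ContinuousLinearMapWOT.ofCLM_apply, sum_apply, inner_sum]

theorem inner_star_left (A : Op Λ) (f g : ell2 Λ) : ⟪star A f, g⟫ = ⟪f, A g⟫ := by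
  rw [ContinuousLinearMap.star_eq_adjoint, ContinuousLinearMap.adjoint_inner_left]

theorem norm_star_op (A : Op Λ) : ‖star A‖ = ‖A‖ := norm_star A

theorem norm_star_mul_self_op (A : Op Λ) : ‖star A * A‖ = ‖A‖ * ‖A‖ :=
  ContinuousLinearMap.norm_adjoint_comp_self A

theorem exists_eq_star_mul_self {H : Type*} [NormedAddCommGroup H]
    [InnerProductSpace ℂ H] [CompleteSpace H] {A : H →L[ℂ] H} (hA : 0 ≤ A) :
    ∃ b : H →L[ℂ] H, A = star b * b :=
  CStarAlgebra.nonneg_iff_eq_star_mul_self.1 hA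

/-! ### Norms and supports of the effective terms -/

namespace LocalLindbladian

theorem hasSum_inner_lindbladian (L : LocalLindbladian Λ R I N) (σ : Op Λ) (φ ψ : ell2 Λ) :
    HasSum (fun Z => ⟪φ, L.term Z σ ψ⟫) ⟪φ, L.lindbladian σ ψ⟫ := by
  obtain ⟨C, h⟩ := L.hasSum_term
  exact hasSum_inner_of_wot (h σ).1 φ ψ

/-- The contribution of `Z` to the effective generator. -/
noncomputable def effTerm (L : LocalLindbladian Λ R I N) (Z : Set Λ) : Op Λ :=
  -Complex.I • L.h Z - (1 / 2 : ℂ) • ∑ α, star (L.jump Z α) * L.jump Z α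

theorem nonneg_bound (L : LocalLindbladian Λ R I N) : 0 ≤ N :=
  (norm_nonneg _).trans (L.h_norm ∅)

theorem norm_effTerm_le (L : LocalLindbladian Λ R I N) (Z : Set Λ) :
    ‖L.effTerm Z‖ ≤ N + I * N ^ 2 := by
  have hN := L.nonneg_bound
  have h1 : ‖-Complex.I • L.h Z‖ ≤ N := by
    rw [norm_smul]; simpa using L.h_norm Z
  have h2 : ‖∑ α, star (L.jump Z α) * L.jump Z α‖ ≤ I * N ^ 2 := by
    refine (norm_sum_le _ _).trans ?_
    have h3 : ∀ α ∈ Finset.univ, ‖star (L.jump Z α) * L.jump Z α‖ ≤ N ^ 2 := fun α _ => by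
      rw [norm_star_mul_self_op, sq]
      exact mul_le_mul (L.jump_norm Z α) (L.jump_norm Z α) (norm_nonneg _) hN
    refine (Finset.sum_le_card_nsmul _ _ _ h3).trans ?_
    rw [Finset.card_univ, Fintype.card_fin, nsmul_eq_mul]
    exact mul_le_mul_of_nonneg_right (by exact_mod_cast L.numJump_le Z) (by positivity)
  refine (norm_sub_le _ _).trans (add_le_add h1 ?_)
  rw [norm_smul]
  have h4 : ‖(1 / 2 : ℂ)‖ = 1 / 2 := by norm_num
  rw [h4]
  nlinarith [norm_nonneg (∑ α, star (L.jump Z α) * L.jump Z α)]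

/-- The joint support of the terms belonging to `Z`. -/
def termSupport (L : LocalLindbladian Λ R I N) (Z : Set Λ) : Set Λ :=
  opSupport (L.h Z) ∪ ⋃ α, opSupport (L.jump Z α)

theorem h_support' (L : LocalLindbladian Λ R I N) (Z : Set Λ) :
    opSupport (L.h Z) ⊆ L.termSupport Z := Set.subset_union_left

theorem jump_support' (L : LocalLindbladian Λ R I N) (Z : Set Λ) (α : Fin (L.numJump Z)) :
    opSupport (L.jump Z α) ⊆ L.termSupport Z :=
  (Set.subset_iUnion (fun α => opSupport (L.jump Z α)) α).trans Set.subset_union_right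

theorem termSupport_subset (L : LocalLindbladian Λ R I N) (Z : Set Λ) : L.termSupport Z ⊆ Z :=
  Set.union_subset (L.h_support Z) (Set.iUnion_subset (L.jump_support Z))

/-- The true support is used instead of `Z` because `ActsWithin` restricts only the supports of the
boundary terms, not the sets that label them. -/
theorem effTerm_apply_delta (L : LocalLindbladian Λ R I N) {Z : Set Λ} {u : Λ}
    (hu : u ∉ L.termSupport Z) : L.effTerm Z (delta u) = 0 := by
  simp [effTerm, apply_delta_eq_zero (L.h_support' Z) hu,
    apply_delta_eq_zero (L.jump_support' Z _) hu]

theorem star_effTerm_apply_delta (L : LocalLindbladian Λ R I N) {Z : Set Λ} {u : Λ}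
    (hu : u ∉ L.termSupport Z) : star (L.effTerm Z) (delta u) = 0 := by
  simp [effTerm, (L.h_selfAdjoint Z).star_eq, apply_delta_eq_zero (L.h_support' Z) hu,
    apply_delta_eq_zero (L.jump_support' Z _) hu]

theorem opSupport_effTerm (L : LocalLindbladian Λ R I N) (Z : Set Λ) :
    opSupport (L.effTerm Z) ⊆ Z := by
  rintro u ⟨v, h⟩
  by_contra hu
  have hu' := fun h => hu (L.termSupport_subset Z h)
  rw [L.effTerm_apply_delta hu', ← inner_star_left, L.star_effTerm_apply_delta hu'] at h
  simp at h

theorem effTerm_eq_zero (L : LocalLindbladian Λ R I N) {Z : Set Λ} (hZ : (R : ℕ∞) < diam Z) :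
    L.effTerm Z = 0 := by
  simp [effTerm, L.h_eq_zero Z hZ, L.jump_eq_zero Z _ hZ]

theorem hasSum_inner_effective (L : LocalLindbladian Λ R I N) (φ ψ : ell2 Λ) :
    HasSum (fun Z => ⟪φ, L.effTerm Z ψ⟫) ⟪φ, L.effective ψ⟫ := by
  obtain ⟨K, hK, h⟩ := exists_sum_locNorm_mul (Λ := Λ) R
  have hN := L.nonneg_bound
  refine hasSum_inner_of_wot (hasSum_wot (C := (N + I * N ^ 2) * K) (by positivity)
    fun φ ψ F => ?_).1 φ ψ
  calc ∑ Z ∈ F, ‖⟪φ, L.effTerm Z ψ⟫‖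
      ≤ ∑ Z ∈ F, (N + I * N ^ 2) * (locNorm R Z φ * locNorm R Z ψ) :=
        Finset.sum_le_sum fun Z _ => (norm_inner_le_locNorm (L.opSupport_effTerm Z)
          (fun h => L.effTerm_eq_zero h) φ ψ).trans (mul_le_mul_of_nonneg_right
            (L.norm_effTerm_le Z) (mul_nonneg (locNorm_nonneg _ _) (locNorm_nonneg _ _)))
    _ ≤ (N + I * N ^ 2) * (K * (‖φ‖ * ‖ψ‖)) := by
        rw [← Finset.mul_sum]
        exact mul_le_mul_of_nonneg_left (h φ ψ F) (by positivity)
    _ = _ := by ring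

/-- Commutator and anticommutator merge into one non-hermitian multiplication on each side. What
remains is completely positive, and it has no matrix element at a pair of sites unless both are in
the support. -/
theorem term_eq (L : LocalLindbladian Λ R I N) (Z : Set Λ) (ρ : Op Λ) :
    L.term Z ρ = L.effTerm Z * ρ + ρ * star (L.effTerm Z) +
      ∑ α, L.jump Z α * ρ * star (L.jump Z α) := by
  have h1 : star (L.effTerm Z) =
      Complex.I • L.h Z - (1 / 2 : ℂ) • ∑ α, star (L.jump Z α) * L.jump Z α := by
    simp [effTerm, (L.h_selfAdjoint Z).star_eq]
  rw [h1, term, effTerm]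
  simp only [Finset.sum_sub_distrib, ← Finset.smul_sum, Finset.sum_add_distrib, sub_mul, mul_sub,
    smul_mul_assoc, mul_smul_comm, Finset.sum_mul, Finset.mul_sum, smul_sub, smul_add, neg_smul, neg_mul]
  abel

theorem norm_term_le (L : LocalLindbladian Λ R I N) (Z : Set Λ) (ρ : Op Λ) :
    ‖L.term Z ρ‖ ≤ (2 * N + 3 * (I * N ^ 2)) * ‖ρ‖ := by
  have hN := L.nonneg_bound
  have h0 := L.norm_effTerm_le Z
  have h1 : ‖L.effTerm Z * ρ‖ ≤ (N + I * N ^ 2) * ‖ρ‖ :=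
    (norm_mul_le _ _).trans (mul_le_mul_of_nonneg_right h0 (norm_nonneg _))
  have h2 : ‖ρ * star (L.effTerm Z)‖ ≤ (N + I * N ^ 2) * ‖ρ‖ := by
    refine (norm_mul_le _ _).trans ?_
    rw [norm_star_op, mul_comm]
    exact mul_le_mul_of_nonneg_right h0 (norm_nonneg _)
  have h3 : ‖∑ α, L.jump Z α * ρ * star (L.jump Z α)‖ ≤ I * (N ^ 2 * ‖ρ‖) := by
    refine (norm_sum_le _ _).trans ?_
    have h3 : ∀ α ∈ Finset.univ, ‖L.jump Z α * ρ * star (L.jump Z α)‖ ≤ N ^ 2 * ‖ρ‖ :=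
      fun α _ => by
        have hj := L.jump_norm Z α
        calc _ ≤ ‖L.jump Z α‖ * ‖ρ‖ * ‖star (L.jump Z α)‖ :=
              (norm_mul_le _ _).trans (mul_le_mul_of_nonneg_right (norm_mul_le _ _)
                (norm_nonneg _))
          _ ≤ N * ‖ρ‖ * N := by rw [norm_star_op]; gcongr
          _ = _ := by ring
    refine (Finset.sum_le_card_nsmul _ _ _ h3).trans ?_
    rw [Finset.card_univ, Fintype.card_fin, nsmul_eq_mul]
    exact mul_le_mul_of_nonneg_right (by exact_mod_cast L.numJump_le Z) (by positivity)
  rw [term_eq]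
  -- The constant is `2 (N + I N²) + I N²`.
  refine (norm_add₃_le).trans ((add_le_add_three h1 h2 h3).trans (le_of_eq (by ring)))

end LocalLindbladian

/-! ### Hilbert–Schmidt sums and the trace -/

theorem enorm_sq_eq_tsum (φ : ell2 Λ) : ‖φ‖ₑ ^ 2 = ∑' u, ‖φ u‖ₑ ^ 2 := by
  have h := lp.hasSum_norm (p := 2) (by norm_num) φ
  simp only [ENNReal.toReal_ofNat, Real.rpow_ofNat] at h
  have h2 : ∀ {E : Type _} [NormedAddCommGroup E] (a : E), ‖a‖ₑ ^ 2 = ENNReal.ofReal (‖a‖ ^ 2) :=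
    fun a => by rw [ENNReal.ofReal_pow (norm_nonneg _), ofReal_norm]
  rw [h2, ← h.tsum_eq, ENNReal.ofReal_tsum_of_nonneg (fun _ => by positivity) h.summable]
  exact tsum_congr fun u => by
    rw [ENNReal.ofReal_pow (norm_nonneg _), ofReal_norm]

/-- The square of the Hilbert–Schmidt norm. -/
noncomputable def hsSum (A : Op Λ) : ENNReal := ∑' u, ‖A (delta u)‖ₑ ^ 2

/-- Both sides are the double sum of the squared moduli of the matrix elements. Sums in `[0, ∞]` may
be exchanged freely, so this serves as cyclicity of the trace without any trace-class theory. -/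
theorem hsSum_star (A : Op Λ) : hsSum (star A) = hsSum A := by
  simp only [hsSum, enorm_sq_eq_tsum]
  rw [ENNReal.tsum_comm]
  refine tsum_congr fun u => tsum_congr fun v => ?_
  rw [← inner_delta, ← inner_delta, inner_star, ← inner_conj_symm, RCLike.enorm_conj]

/-- Positive operators of trace at most `c`. -/
def TraceLE (c : ℝ) (A : Op Λ) : Prop :=
  0 ≤ A ∧ ∀ F : Finset Λ, ∑ u ∈ F, (⟪delta u, A (delta u)⟫).re ≤ c

theorem ofReal_re_inner_star_mul_self (b : Op Λ) (φ : ell2 Λ) :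
    ENNReal.ofReal (⟪φ, (star b * b) φ⟫).re = ‖b φ‖ₑ ^ 2 := by
  rw [mul_apply_eq_comp, inner_star]
  have := inner_self_eq_norm_sq (𝕜 := ℂ) (b φ)
  rw [RCLike.re_to_complex] at this
  rw [this, ENNReal.ofReal_pow (norm_nonneg _), ofReal_norm]

theorem re_inner_nonneg {A : Op Λ} (hA : 0 ≤ A) (φ : ell2 Λ) : 0 ≤ (⟪φ, A φ⟫).re :=
  ((ContinuousLinearMap.nonneg_iff_isPositive A).1 hA).re_inner_nonneg_right φ

theorem traceLE_iff_tsum {c : ℝ} (hc : 0 ≤ c) {A : Op Λ} (hA : 0 ≤ A) :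
    TraceLE c A ↔ ∑' u, ENNReal.ofReal (⟪delta u, A (delta u)⟫).re ≤ ENNReal.ofReal c := by
  constructor
  · intro h
    refine ENNReal.summable.tsum_le_of_sum_le fun F => ?_
    rw [← ENNReal.ofReal_sum_of_nonneg fun u _ => re_inner_nonneg hA _]
    exact ENNReal.ofReal_le_ofReal (h.2 F)
  · refine fun h => ⟨hA, fun F => ?_⟩
    rw [← ENNReal.ofReal_le_ofReal_iff hc,
      ENNReal.ofReal_sum_of_nonneg fun u _ => re_inner_nonneg hA _]
    exact (ENNReal.sum_le_tsum F).trans h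

/-- Writing `A = b^* b`, the trace is the squared Hilbert–Schmidt norm of `b`, which dominates `‖b‖²
= ‖A‖` by Cauchy–Schwarz. -/
theorem TraceLE.norm_le {c : ℝ} {A : Op Λ} (h : TraceLE c A) : ‖A‖ ≤ c := by
  classical
  have hc : 0 ≤ c := by simpa using h.2 ∅
  obtain ⟨b, rfl⟩ := exists_eq_star_mul_self h.1
  rw [norm_star_mul_self_op]
  have hb : ∀ F : Finset Λ, ∑ u ∈ F, ‖b (delta u)‖ ^ 2 ≤ c := fun F => by
    refine (Finset.sum_le_sum fun u _ => le_of_eq ?_).trans (h.2 F)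
    rw [mul_apply_eq_comp, inner_star]
    exact (inner_self_eq_norm_sq (𝕜 := ℂ) (b (delta u))).symm
  have key : ‖b‖ ≤ √c := by
    refine b.opNorm_le_bound (Real.sqrt_nonneg _) fun φ => ?_
    have h1 : HasSum (fun u => φ u • b (delta u)) (b φ) := by
      have := b.hasSum (lp.hasSum_single (p := 2) (by norm_num) φ)
      refine this.congr_fun fun u => ?_
      rw [← map_smul]
      congr 1
      rw [delta, ← lp.single_smul, smul_eq_mul, mul_one]
    refine le_of_tendsto (h1.norm) (Filter.Eventually.of_forall fun F => ?_)
    refine (norm_sum_le _ _).trans ?_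
    simp only [norm_smul]
    refine abs_le_of_sq_le_sq' ?_ (by positivity) |>.2
    refine (Finset.sum_mul_sq_le_sq_mul_sq F _ _).trans ?_
    rw [mul_pow, Real.sq_sqrt hc, mul_comm]
    exact mul_le_mul (hb F) (sum_sq_le φ F) (Finset.sum_nonneg fun _ _ => by positivity) hc
  calc ‖b‖ * ‖b‖ ≤ √c * √c := mul_le_mul key key (norm_nonneg _) (Real.sqrt_nonneg _)
    _ = c := Real.mul_self_sqrt hc

theorem TraceLE.add {c c' : ℝ} {A B : Op Λ} (hA : TraceLE c A) (hB : TraceLE c' B) :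
    TraceLE (c + c') (A + B) := by
  refine ⟨add_nonneg hA.1 hB.1, fun F => ?_⟩
  simp only [add_apply, inner_add_right, Complex.add_re, Finset.sum_add_distrib]
  exact add_le_add (hA.2 F) (hB.2 F)

theorem TraceLE.smul {c s : ℝ} (hs : 0 ≤ s) {A : Op Λ} (hA : TraceLE c A) :
    TraceLE (s * c) ((s : ℂ) • A) := by
  refine ⟨smul_nonneg (by exact_mod_cast hs) hA.1, fun F => ?_⟩
  simp only [smul_apply, inner_smul_right, Complex.re_ofReal_mul, ← Finset.mul_sum]
  exact mul_le_mul_of_nonneg_left (hA.2 F) hs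

theorem TraceLE.zero : TraceLE 0 (0 : Op Λ) := ⟨le_rfl, fun F => by simp⟩

/-- Only finite partial traces are bounded, and these are continuous in the operator norm. Hence the
condition passes to norm limits, although the trace itself is not norm continuous. -/
theorem TraceLE.of_tendsto {ι : Type*} {l : Filter ι} [l.NeBot] {c : ι → ℝ} {A : ι → Op Λ}
    {c' : ℝ} {A' : Op Λ} (h : ∀ᶠ i in l, TraceLE (c i) (A i))
    (hc : Filter.Tendsto c l (nhds c')) (hA : Filter.Tendsto A l (nhds A')) : TraceLE c' A' := by
  refine ⟨ge_of_tendsto hA (h.mono fun i hi => hi.1), fun F => ?_⟩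
  refine le_of_tendsto_of_tendsto ?_ hc (h.mono fun i hi => hi.2 F)
  have : Continuous fun B : Op Λ => ∑ u ∈ F, (⟪delta u, B (delta u)⟫).re := by fun_prop
  exact (this.tendsto A').comp hA

/-! ### Semigroups preserving a gauge -/

/-- A closed family of bounds `c ↦ {A | Q c A}` on a normed space, additive and positively
homogeneous. -/
structure IsGauge {W : Type*} [NormedAddCommGroup W] [NormedSpace ℂ W] (Q : ℝ → W → Prop) :
    Prop where
  zero : Q 0 0
  add : ∀ {c c' A B}, Q c A → Q c' B → Q (c + c') (A + B)
  smul : ∀ {c s A}, 0 ≤ s → Q c A → Q (s * c) ((s : ℂ) • A)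
  of_tendsto : ∀ {ι : Type} {l : Filter ι} [l.NeBot] {c : ι → ℝ} {A : ι → W} {c' A'},
    (∀ᶠ i in l, Q (c i) (A i)) → Filter.Tendsto c l (nhds c') → Filter.Tendsto A l (nhds A') →
      Q c' A'

theorem exp_smul_one_add {𝔸 : Type*} [NormedRing 𝔸] [NormedAlgebra ℂ 𝔸] [CompleteSpace 𝔸] (z : ℂ)
    (x : 𝔸) : NormedSpace.exp (z • 1 + x) = Complex.exp z • NormedSpace.exp x := by
  let := NormedAlgebra.restrictScalars ℚ ℂ 𝔸
  rw [← Algebra.algebraMap_eq_smul_one,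
    NormedSpace.exp_add_of_commute (Algebra.commute_algebraMap_left _ _),
    ← NormedSpace.algebraMap_exp_comm, ← Complex.exp_eq_exp_ℂ, Algebra.algebraMap_eq_smul_one,
    smul_mul_assoc, one_mul]

theorem continuous_exp_smul_add_smul {𝔸 : Type*} [NormedRing 𝔸] [NormedAlgebra ℂ 𝔸]
    [CompleteSpace 𝔸] (t : ℝ) (x k : 𝔸) :
    Continuous fun s : ℝ => NormedSpace.exp ((t : ℂ) • (x + (s : ℂ) • k)) := by
  let := NormedAlgebra.restrictScalars ℚ ℂ 𝔸
  exact NormedSpace.exp_continuous.comp (by fun_prop)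

namespace IsGauge

variable {W : Type*} [NormedAddCommGroup W] [NormedSpace ℂ W] {Q : ℝ → W → Prop}

theorem sum (hQ : IsGauge Q) {ι : Type*} (F : Finset ι) {c : ι → ℝ} {A : ι → W}
    (h : ∀ i ∈ F, Q (c i) (A i)) : Q (∑ i ∈ F, c i) (∑ i ∈ F, A i) := by
  classical
  induction F using Finset.induction_on with
  | empty => exact hQ.zero
  | insert i F hi ih =>
    rw [Finset.sum_insert hi, Finset.sum_insert hi]
    exact hQ.add (h i (Finset.mem_insert_self _ _))
      (ih fun j hj => h j (Finset.mem_insert_of_mem hj))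

/-- The exponential series has nonnegative weights `a ^ n / n!`, and `P ^ n` scales the bound by `q
^ n`; the partial sums of operators and bounds converge together. -/
theorem exp [CompleteSpace W] (hQ : IsGauge Q) {P : W →L[ℂ] W} {q : ℝ}
    (hP : ∀ c A, Q c A → Q (q * c) (P A)) {a : ℝ} (ha : 0 ≤ a) {c : ℝ} {A : W} (hA : Q c A) :
    Q (Real.exp (a * q) * c) (NormedSpace.exp ((a : ℂ) • P) A) := by
  have hpow : ∀ n : ℕ, Q (q ^ n * c) ((P ^ n) A) := fun n => by
    induction n with
    | zero => simpa using hA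
    | succ n ih =>
      rw [pow_succ', pow_succ', mul_assoc]
      exact hP _ _ ih
  have h1 : HasSum (fun n : ℕ => (((n.factorial : ℝ)⁻¹ * a ^ n : ℝ) : ℂ) • (P ^ n) A)
      (NormedSpace.exp ((a : ℂ) • P) A) := by
    have h2 := NormedSpace.exp_series_hasSum_exp' (𝕂 := ℂ) ((a : ℂ) • P)
    have h3 := (ContinuousLinearMap.apply ℂ W A).hasSum h2
    refine h3.congr_fun fun n => ?_
    rw [smul_pow, smul_smul]
    simp
  have h2 : HasSum (fun n : ℕ => ((n.factorial : ℝ)⁻¹ * a ^ n) * (q ^ n * c))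
      (Real.exp (a * q) * c) := by
    have h3 := (NormedSpace.expSeries_div_hasSum_exp (a * q)).mul_right c
    rw [← Real.exp_eq_exp_ℝ] at h3
    refine h3.congr_fun fun n => ?_
    rw [mul_pow]; field_simp
  exact hQ.of_tendsto (Filter.Eventually.of_forall fun F => hQ.sum F fun n _ =>
    hQ.smul (by positivity) (hpow n)) h2 h1

/-- A gauge is preserved by a semigroup if it is preserved by the Euler steps up to second order. -/
theorem exp_of_step [CompleteSpace W] (hQ : IsGauge Q) {G K : W →L[ℂ] W} {κ : ℝ}
    (hP : ∀ s : ℝ, 0 < s → ∀ c A, Q c A →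
      Q ((1 + s ^ 2 * κ) * c) (A + (s : ℂ) • G A + ((s : ℂ) * s) • K A))
    {t : ℝ} (ht : 0 ≤ t) {c : ℝ} {A : W} (hA : Q c A) :
    Q c (NormedSpace.exp ((t : ℂ) • G) A) := by
  -- The Euler step is exactly `1 + s T_s` for the perturbed generator `T_s`, and `T_s → G` as `s →
  -- 0`.
  let T : ℝ → W →L[ℂ] W := fun s => G + (s : ℂ) • K
  have hT : ∀ (s : ℝ) (A : W),
      (1 + (s : ℂ) • T s) A = A + (s : ℂ) • G A + ((s : ℂ) * s) • K A := fun s A => by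
    simp [T, mul_smul, add_assoc]
  have key : ∀ s : ℝ, 0 < s → Q (Real.exp (t * s * κ) * c)
      (NormedSpace.exp ((t : ℂ) • T s) A) := fun s hs => by
    -- Since `e^{t T_s} = e^{-t/s} e^{(t/s)(1 + s T_s)}`, the bound grows by `e^{-t/s} e^{(t/s)(1 +
    -- s² κ)} = e^{t s κ}`, which tends to `1` as `s → 0`.
    have h1 := hQ.exp (P := 1 + (s : ℂ) • T s) (q := 1 + s ^ 2 * κ)
      (fun c A h => by rw [hT]; exact hP s hs c A h) (a := t / s) (by positivity) hA
    have h2 : ((t / s : ℝ) : ℂ) • (1 + (s : ℂ) • T s) =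
        ((t / s : ℝ) : ℂ) • 1 + (t : ℂ) • T s := by
      have : (s : ℂ) ≠ 0 := by exact_mod_cast hs.ne'
      rw [smul_add, smul_smul]
      congr 2
      push_cast; field_simp
    rw [h2, exp_smul_one_add, ← Complex.ofReal_exp] at h1
    have h4 := hQ.smul (Real.exp_pos (-(t / s))).le h1
    have h5 : ((Real.exp (-(t / s)) : ℝ) : ℂ) • (((Real.exp (t / s) : ℝ) : ℂ) •
        NormedSpace.exp ((t : ℂ) • T s)) A = NormedSpace.exp ((t : ℂ) • T s) A := by
      rw [smul_apply, smul_smul, ← Complex.ofReal_mul, ← Real.exp_add]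
      simp
    have h6 : Real.exp (-(t / s)) * (Real.exp (t / s * (1 + s ^ 2 * κ)) * c) =
        Real.exp (t * s * κ) * c := by
      rw [← mul_assoc, ← Real.exp_add]
      congr 2
      field_simp
      ring
    rwa [h5, h6] at h4
  refine hQ.of_tendsto (l := nhdsWithin (0 : ℝ) (Set.Ioi 0))
    (c := fun s => Real.exp (t * s * κ) * c)
    (A := fun s => NormedSpace.exp ((t : ℂ) • T s) A)
    (Filter.eventually_of_mem self_mem_nhdsWithin key) ?_ ?_
  · have : Continuous fun s : ℝ => Real.exp (t * s * κ) * c := by fun_prop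
    simpa using (this.tendsto 0).mono_left nhdsWithin_le_nhds
  · have h2 : Continuous fun s : ℝ => NormedSpace.exp ((t : ℂ) • T s) A :=
      (ContinuousLinearMap.apply ℂ W A).continuous.comp (continuous_exp_smul_add_smul t G K)
    have h3 := (h2.tendsto 0).mono_left (nhdsWithin_le_nhds (s := Set.Ioi 0))
    have h4 : T 0 = G := by simp [T]
    rw [h4] at h3
    exact h3

end IsGauge

theorem isGauge_traceLE : IsGauge (TraceLE (Λ := Λ)) :=
  ⟨TraceLE.zero, TraceLE.add, fun hs h => h.smul hs, TraceLE.of_tendsto⟩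

theorem re_inner_star_mul_self (b : Op Λ) (φ : ell2 Λ) :
    (⟪φ, (star b * b) φ⟫).re = ‖b φ‖ ^ 2 := by
  rw [mul_apply_eq_comp, inner_star]
  exact inner_self_eq_norm_sq (𝕜 := ℂ) (b φ)

theorem nonneg_of_inner {A : Op Λ} (h : ∀ φ, 0 ≤ ⟪φ, A φ⟫) : 0 ≤ A := by
  rw [ContinuousLinearMap.nonneg_iff_isPositive, ContinuousLinearMap.isPositive_iff_complex]
  intro φ
  have h1 := Complex.nonneg_iff.1 (h φ)
  have h2 : ⟪A φ, φ⟫ = ⟪φ, A φ⟫ := by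
    rw [← inner_conj_symm, Complex.conj_eq_iff_im, h1.2]
  rw [h2]
  exact ⟨Complex.ext rfl h1.2, h1.1⟩

/-! ### Positivity and trace of the Euler step -/

namespace LocalLindbladian

/-- The Hamiltonian terms have real expectation, so `-i h_Z` drops out of the real part. This
balance between loss and jumps gives both trace control and the dissipativity of the effective
generators. -/
theorem hasSum_norm_jump (L : LocalLindbladian Λ R I N) (ψ : ell2 Λ) :
    HasSum (fun Z => ∑ α, ‖L.jump Z α ψ‖ ^ 2) (-2 * (⟪ψ, L.effective ψ⟫).re) := by
  have h1 := (Complex.hasSum_re (L.hasSum_inner_effective ψ ψ)).mul_left (-2)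
  refine h1.congr_fun fun Z => ?_
  have h2 : (⟪ψ, L.h Z ψ⟫).im = 0 := by
    have h3 : ⟪ψ, L.h Z ψ⟫ = starRingEnd ℂ ⟪ψ, L.h Z ψ⟫ := by
      rw [inner_conj_symm, ← inner_star, (L.h_selfAdjoint Z).star_eq]
    have h4 := congrArg Complex.im h3
    rw [Complex.conj_im] at h4
    linarith
  have h3 : ∀ α, (⟪ψ, star (L.jump Z α) (L.jump Z α ψ)⟫).re = ‖L.jump Z α ψ‖ ^ 2 := fun α =>
    re_inner_star_mul_self (L.jump Z α) ψ
  have h5 : ∀ z : ℂ, ((1 / 2 : ℂ) * z).re = z.re / 2 := fun z => by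
    simp [Complex.mul_re]; ring
  rw [effTerm, sub_apply, inner_sub_right, smul_apply, smul_apply, inner_smul_right,
    inner_smul_right, sum_apply, inner_sum, Complex.sub_re, h5, Complex.re_sum]
  simp [h2, h3]
  ring

/-- The completely positive part of the Lindbladian. -/
noncomputable def jumpPart (L : LocalLindbladian Λ R I N) (A : Op Λ) : Op Λ :=
  L.lindbladian A - L.effective * A - A * star L.effective

theorem hasSum_inner_star_effective (L : LocalLindbladian Λ R I N) (A : Op Λ) (φ ψ : ell2 Λ) :
    HasSum (fun Z => ⟪φ, A (star (L.effTerm Z) ψ)⟫) ⟪φ, A (star L.effective ψ)⟫ := by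
  have h4 := (L.hasSum_inner_effective ψ (star A φ)).star
  simp only [RCLike.star_def, inner_conj_symm] at h4
  simpa only [inner_star_left, ← inner_star, star_star] using h4

/-- The three weak sums defining `jumpPart` converge separately, so the effective terms cancel set
by set and only the sandwiches remain. -/
theorem hasSum_inner_jumpPart (L : LocalLindbladian Λ R I N) (A : Op Λ) (φ ψ : ell2 Λ) :
    HasSum (fun Z => ∑ α, ⟪φ, (L.jump Z α * A * star (L.jump Z α)) ψ⟫)
      ⟪φ, L.jumpPart A ψ⟫ := by
  have h1 := L.hasSum_inner_lindbladian A φ ψ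
  have h2 := L.hasSum_inner_effective φ (A ψ)
  have h3 := L.hasSum_inner_star_effective A φ ψ
  have h5 := (h1.sub h2).sub h3
  have h6 : ⟪φ, L.jumpPart A ψ⟫ = ⟪φ, L.lindbladian A ψ⟫ - ⟪φ, L.effective (A ψ)⟫ -
      ⟪φ, A (star L.effective ψ)⟫ := by
    simp only [jumpPart, sub_apply, inner_sub_right, mul_apply_eq_comp]
  rw [h6]
  refine h5.congr_fun fun Z => ?_
  rw [term_eq, add_apply, add_apply, inner_add_right, inner_add_right, sum_apply, inner_sum]
  simp only [mul_apply_eq_comp]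
  ring

theorem jumpPart_nonneg (L : LocalLindbladian Λ R I N) {A : Op Λ} (hA : 0 ≤ A) :
    0 ≤ L.jumpPart A := by
  refine nonneg_of_inner fun φ => (L.hasSum_inner_jumpPart A φ φ).nonneg fun Z =>
    Finset.sum_nonneg fun α _ => ?_
  have h1 : 0 ≤ L.jump Z α * A * star (L.jump Z α) := star_right_conjugate_nonneg hA _
  exact ((ContinuousLinearMap.nonneg_iff_isPositive _).1 h1).inner_nonneg_right φ

theorem ofReal_re_inner_jumpPart (L : LocalLindbladian Λ R I N) (b : Op Λ) (φ : ell2 Λ) :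
    ENNReal.ofReal (⟪φ, L.jumpPart (star b * b) φ⟫).re =
      ∑' Z, ∑ α, ‖(b * star (L.jump Z α)) φ‖ₑ ^ 2 := by
  have h1 := Complex.hasSum_re (L.hasSum_inner_jumpPart (star b * b) φ φ)
  have h2 : ∀ Z α, (⟪φ, (L.jump Z α * (star b * b) * star (L.jump Z α)) φ⟫).re =
      ‖(b * star (L.jump Z α)) φ‖ ^ 2 := fun Z α => by
    rw [← re_inner_star_mul_self, star_mul, star_star, mul_assoc, mul_assoc, mul_assoc]
  simp only [Complex.re_sum, h2] at h1
  rw [← h1.tsum_eq, ENNReal.ofReal_tsum_of_nonneg (fun _ => by positivity) h1.summable]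
  refine tsum_congr fun Z => ?_
  rw [ENNReal.ofReal_sum_of_nonneg fun _ _ => by positivity]
  refine Finset.sum_congr rfl fun α _ => ?_
  rw [ENNReal.ofReal_pow (norm_nonneg _), ofReal_norm]

/-- The positive map `A ↦ (1 + sD) A (1 + sD)^* + s Φ(A)`, which agrees with `1 + sℒ` up to second
order in `s`. -/
noncomputable def stepMap (L : LocalLindbladian Λ R I N) (s : ℝ) (A : Op Λ) : Op Λ :=
  (1 + (s : ℂ) • L.effective) * A * star (1 + (s : ℂ) • L.effective) + (s : ℂ) • L.jumpPart A

theorem stepMap_eq (L : LocalLindbladian Λ R I N) (s : ℝ) (A : Op Λ) :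
    L.stepMap s A = A + (s : ℂ) • L.lindbladian A +
      ((s : ℂ) * s) • (L.effective * A * star L.effective) := by
  simp only [stepMap, jumpPart, mul_smul, star_add, star_one, star_smul, RCLike.star_def,
    Complex.conj_ofReal, add_mul, mul_add, one_mul, mul_one, smul_mul_assoc, mul_smul_comm,
    smul_sub, smul_add]
  abel

/-- In `‖ψ + s G ψ‖²` the first-order term `2 s Re ⟪ψ, G ψ⟫` is cancelled exactly by the jump sum
(`hasSum_norm_jump`), leaving an error of order `s²`. -/
theorem re_inner_step (L : LocalLindbladian Λ R I N) {s : ℝ} (hs : 0 ≤ s) (ψ : ell2 Λ) :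
    ‖(1 + (s : ℂ) • L.effective) ψ‖ₑ ^ 2 + ENNReal.ofReal s * ∑' Z, ∑ α, ‖L.jump Z α ψ‖ₑ ^ 2 ≤
      ENNReal.ofReal (1 + s ^ 2 * ‖L.effective‖ ^ 2) * ‖ψ‖ₑ ^ 2 := by
  have h1 := L.hasSum_norm_jump ψ
  have h2 : ∑' Z, ∑ α, ‖L.jump Z α ψ‖ₑ ^ 2 = ENNReal.ofReal (-2 * (⟪ψ, L.effective ψ⟫).re) := by
    rw [← h1.tsum_eq, ENNReal.ofReal_tsum_of_nonneg (fun _ => by positivity) h1.summable]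
    refine tsum_congr fun Z => ?_
    rw [ENNReal.ofReal_sum_of_nonneg fun _ _ => by positivity]
    refine Finset.sum_congr rfl fun α _ => ?_
    rw [ENNReal.ofReal_pow (norm_nonneg _), ofReal_norm]
  have h3 : 0 ≤ -2 * (⟪ψ, L.effective ψ⟫).re := h1.nonneg fun Z => by positivity
  have h4 : ‖(1 + (s : ℂ) • L.effective) ψ‖ ^ 2 =
      ‖ψ‖ ^ 2 + 2 * (s * (⟪ψ, L.effective ψ⟫).re) + s ^ 2 * ‖L.effective ψ‖ ^ 2 := by
    have := norm_add_sq (𝕜 := ℂ) ψ ((s : ℂ) • L.effective ψ)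
    rw [inner_smul_right, RCLike.re_to_complex, Complex.re_ofReal_mul, norm_smul,
      Complex.norm_real, mul_pow, Real.norm_eq_abs, sq_abs] at this
    exact this
  rw [h2, ← ofReal_norm, ← ofReal_norm, ← ENNReal.ofReal_pow (norm_nonneg _),
    ← ENNReal.ofReal_pow (norm_nonneg _), ← ENNReal.ofReal_mul hs,
    ← ENNReal.ofReal_add (by positivity) (by positivity), ← ENNReal.ofReal_mul (by positivity), h4]
  refine ENNReal.ofReal_le_ofReal ?_
  have h5 : ‖L.effective ψ‖ ^ 2 ≤ ‖L.effective‖ ^ 2 * ‖ψ‖ ^ 2 := by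
    rw [← mul_pow]
    exact pow_le_pow_left₀ (norm_nonneg _) (L.effective.le_opNorm ψ) 2
  have h6 := mul_le_mul_of_nonneg_left h5 (sq_nonneg s)
  linarith

/-- With `A = b^* b`, cyclicity turns the trace of the step into a sum over `u` of the left side of
`re_inner_step` at `ψ = b^* δ_u`, while the trace of `A` is the sum of the `‖b^* δ_u‖²`. -/
theorem traceLE_stepMap (L : LocalLindbladian Λ R I N) {s c : ℝ} (hs : 0 ≤ s) {A : Op Λ}
    (hA : TraceLE c A) : TraceLE ((1 + s ^ 2 * ‖L.effective‖ ^ 2) * c) (L.stepMap s A) := by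
  have hc : 0 ≤ c := by simpa using hA.2 ∅
  obtain ⟨b, rfl⟩ := exists_eq_star_mul_self hA.1
  have hpos : 0 ≤ L.jumpPart (star b * b) := L.jumpPart_nonneg hA.1
  have hpos' : 0 ≤ (1 + (s : ℂ) • L.effective) * (star b * b) *
    star (1 + (s : ℂ) • L.effective) := star_right_conjugate_nonneg hA.1 _
  have hpos'' : 0 ≤ L.stepMap s (star b * b) :=
    add_nonneg hpos' (smul_nonneg (by exact_mod_cast hs) hpos)
  rw [traceLE_iff_tsum (by positivity) hpos'']
  rw [traceLE_iff_tsum hc hA.1] at hA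
  set X := 1 + (s : ℂ) • L.effective with hX
  have h1 : ∀ u : Λ, ENNReal.ofReal (⟪delta u, L.stepMap s (star b * b) (delta u)⟫).re =
      ‖(b * star X) (delta u)‖ₑ ^ 2 +
        ENNReal.ofReal s * ∑' Z, ∑ α, ‖(b * star (L.jump Z α)) (delta u)‖ₑ ^ 2 := fun u => by
    have h2 : X * (star b * b) * star X = star (b * star X) * (b * star X) := by
      rw [star_mul, star_star, mul_assoc, mul_assoc, mul_assoc]
    rw [stepMap, add_apply, inner_add_right, Complex.add_re, smul_apply, inner_smul_right,
      Complex.re_ofReal_mul, ENNReal.ofReal_add (re_inner_nonneg hpos' _)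
      (mul_nonneg hs (re_inner_nonneg hpos _)), ENNReal.ofReal_mul hs,
      ofReal_re_inner_jumpPart, h2, ofReal_re_inner_star_mul_self]
  -- Cyclicity of the trace, in the form of equality of the Hilbert–Schmidt norms of an operator and
  -- its adjoint.
  have h2 : ∀ Y : Op Λ, hsSum (b * star Y) = hsSum (Y * star b) := fun Y => by
    rw [← hsSum_star, star_mul, star_star]
  have h3 : ∀ Y : Op Λ, ∑' u, ‖(b * star Y) (delta u)‖ₑ ^ 2 =
      ∑' u, ‖Y (star b (delta u))‖ₑ ^ 2 := h2
  have h4 : ∑' u, ENNReal.ofReal (⟪delta u, L.stepMap s (star b * b) (delta u)⟫).re =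
      ∑' u, (‖X (star b (delta u))‖ₑ ^ 2 +
        ENNReal.ofReal s * ∑' Z, ∑ α, ‖L.jump Z α (star b (delta u))‖ₑ ^ 2) := by
    simp only [h1]
    rw [ENNReal.tsum_add, ENNReal.tsum_add, h3, ENNReal.tsum_mul_left, ENNReal.tsum_mul_left,
      ENNReal.tsum_comm, ENNReal.tsum_comm (α := Λ)]
    congr 3
    funext Z
    rw [Summable.tsum_finsetSum fun _ _ => ENNReal.summable,
      Summable.tsum_finsetSum fun _ _ => ENNReal.summable]
    exact Finset.sum_congr rfl fun α _ => h3 _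
  rw [h4, ENNReal.ofReal_mul (by positivity)]
  refine (ENNReal.tsum_le_tsum fun u => L.re_inner_step hs _).trans ?_
  rw [ENNReal.tsum_mul_left]
  refine mul_le_mul_right ?_ _
  refine le_trans (le_of_eq ?_) hA
  simp only [ofReal_re_inner_star_mul_self]
  exact hsSum_star b

end LocalLindbladian

/-- By `stepMap_eq` the positive step exceeds `1 + s ℒ` by `s²` times the bounded map `A ↦ G A G^*`,
so the Euler argument applies with `κ = ‖G‖²`. -/
theorem LocalLindbladian.traceLE_evolution (L : LocalLindbladian Λ R I N) {t c : ℝ} (ht : 0 ≤ t)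
    {A : Op Λ} (hA : TraceLE c A) : TraceLE c (L.evolution t A) :=
  isGauge_traceLE.exp_of_step (G := L.lindbladian)
    (K := ContinuousLinearMap.mulLeftRight ℂ (Op Λ) L.effective (star L.effective))
    (fun s hs c A h => by
      have h1 := L.traceLE_stepMap hs.le h
      rwa [L.stepMap_eq] at h1) ht hA

theorem IsState.traceLE {ρ : Op Λ} (hρ : IsState ρ) : TraceLE 1 ρ := by
  have h0 := (ContinuousLinearMap.nonneg_iff_isPositive ρ).2 hρ.1
  refine ⟨h0, fun F => ?_⟩
  have h1 := Complex.hasSum_re hρ.2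
  rw [Complex.one_re] at h1
  exact sum_le_hasSum F (fun u _ => re_inner_nonneg h0 _) h1

/-! ### Abel averages of a semigroup with a bounded orbit -/

section Abel

open MeasureTheory Filter

variable {W : Type*} [NormedAddCommGroup W] [NormedSpace ℂ W]

theorem norm_exp_smul_le {c ε t : ℝ} {B : W} (h : ‖B‖ ≤ c) :
    ‖(Real.exp (-t * ε) : ℂ) • B‖ ≤ c * Real.exp (-ε * t) := by
  rw [norm_smul, Complex.norm_real, Real.norm_eq_abs, abs_of_pos (Real.exp_pos _), mul_comm,
    show -ε * t = -t * ε by ring]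
  exact mul_le_mul_of_nonneg_right h (Real.exp_pos _).le

theorem norm_abel_le {G : W →L[ℂ] W} {A : W} {ε : ℝ} (hε : 0 < ε)
    (hA : ∀ t : ℝ, 0 ≤ t → ‖NormedSpace.exp ((t : ℂ) • G) A‖ ≤ 1) :
    ‖(ε : ℂ) • ∫ t in Set.Ioi (0 : ℝ),
      (Real.exp (-t * ε) : ℂ) • NormedSpace.exp ((t : ℂ) • G) A‖ ≤ 1 := by
  have h1 : ‖∫ t in Set.Ioi (0 : ℝ),
      (Real.exp (-t * ε) : ℂ) • NormedSpace.exp ((t : ℂ) • G) A‖ ≤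
        ∫ t in Set.Ioi (0 : ℝ), 1 * Real.exp (-ε * t) := by
    refine norm_integral_le_of_norm_le ((integrableOn_exp_mul_Ioi (neg_lt_zero.2 hε) 0).const_mul 1)
      ?_
    filter_upwards [ae_restrict_mem measurableSet_Ioi] with t ht
    exact norm_exp_smul_le (hA t ht.le)
  simp only [one_mul] at h1
  rw [integral_exp_mul_Ioi (neg_lt_zero.2 hε)] at h1
  rw [norm_smul, Complex.norm_real, Real.norm_eq_abs, abs_of_pos hε]
  refine (mul_le_mul_of_nonneg_left h1 hε.le).trans (le_of_eq ?_)
  simp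
  field_simp

variable [CompleteSpace W]

theorem hasDerivAt_exp_smul_apply (G : W →L[ℂ] W) (A : W) (t : ℝ) :
    HasDerivAt (fun t : ℝ => NormedSpace.exp ((t : ℂ) • G) A)
      (G (NormedSpace.exp ((t : ℂ) • G) A)) t := by
  have h1 := (hasDerivAt_exp_smul_const' G (t : ℂ)).scomp t (hasDerivAt_id t).ofReal_comp
  rw [Complex.ofReal_one, one_smul] at h1
  have h2 := ((ContinuousLinearMap.apply ℂ W A).restrictScalars ℝ).hasFDerivAt.comp_hasDerivAt t h1
  exact h2

theorem continuous_exp_smul_apply (G : W →L[ℂ] W) (A : W) :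
    Continuous fun t : ℝ => NormedSpace.exp ((t : ℂ) • G) A :=
  continuous_iff_continuousAt.2 fun t => (hasDerivAt_exp_smul_apply G A t).continuousAt

theorem integrableOn_abel {G : W →L[ℂ] W} {A : W} {ε : ℝ} (hε : 0 < ε)
    (hA : ∀ t : ℝ, 0 ≤ t → ‖NormedSpace.exp ((t : ℂ) • G) A‖ ≤ 1) :
    IntegrableOn (fun t : ℝ => (Real.exp (-t * ε) : ℂ) • NormedSpace.exp ((t : ℂ) • G) A)
      (Set.Ioi 0) := by
  have h1 : Continuous fun t : ℝ =>
      (Real.exp (-t * ε) : ℂ) • NormedSpace.exp ((t : ℂ) • G) A := by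
    have := continuous_exp_smul_apply G A
    fun_prop
  refine Integrable.mono' ((integrableOn_exp_mul_Ioi (neg_lt_zero.2 hε) 0).const_mul 1)
    h1.aestronglyMeasurable ?_
  filter_upwards [ae_restrict_mem measurableSet_Ioi] with t ht
  exact norm_exp_smul_le (hA t ht.le)

/-- The function `f(t) = e^{-tε} e^{tG} A` has derivative `G f - ε f`, value `A` at `0` and limit
`0` at infinity; integrate the derivative over the half-line. Only the orbit of `A` has to be
bounded, not the semigroup. -/
theorem abel_sub_eq {G : W →L[ℂ] W} {A : W} {ε : ℝ} (hε : 0 < ε)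
    (hA : ∀ t : ℝ, 0 ≤ t → ‖NormedSpace.exp ((t : ℂ) • G) A‖ ≤ 1) :
    (ε : ℂ) • (∫ t in Set.Ioi (0 : ℝ),
        (Real.exp (-t * ε) : ℂ) • NormedSpace.exp ((t : ℂ) • G) A) -
      G (∫ t in Set.Ioi (0 : ℝ),
        (Real.exp (-t * ε) : ℂ) • NormedSpace.exp ((t : ℂ) • G) A) = A := by
  have hi := integrableOn_abel hε hA
  set f : ℝ → W := fun t => (Real.exp (-t * ε) : ℂ) • NormedSpace.exp ((t : ℂ) • G) A with hf
  have hd : ∀ t, HasDerivAt f (G (f t) - (ε : ℂ) • f t) t := fun t => by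
    have h1 : HasDerivAt (fun t : ℝ => (Real.exp (-t * ε) : ℂ))
        ((Real.exp (-t * ε) * (-ε) : ℝ) : ℂ) t := by
      have : HasDerivAt (fun t : ℝ => -t * ε) (-ε) t := by
        simpa using (hasDerivAt_id t).neg.mul_const ε
      exact this.exp.ofReal_comp
    have h2 := h1.smul (hasDerivAt_exp_smul_apply G A t)
    refine h2.congr_deriv ?_
    simp only [hf, map_smul, smul_smul, Complex.ofReal_mul, Complex.ofReal_neg]
    rw [sub_eq_add_neg, ← neg_smul]
    congr 2
    ring
  have h1 := integral_Ioi_of_hasDerivAt_of_tendsto (f := f) (m := 0) (a := 0)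
    (hd 0).continuousAt.continuousWithinAt (fun t _ => hd t)
    ((G.integrable_comp hi).sub (hi.smul (ε : ℂ))) ?_
  · have h2 : f 0 = A := by simp [hf]
    rw [h2, zero_sub] at h1
    have h3 := integral_sub (G.integrable_comp hi) (hi.smul (ε : ℂ))
    rw [G.integral_comp_comm hi] at h3
    simp only [Pi.smul_apply] at h3
    rw [integral_smul] at h3
    have h4 := h3.symm.trans h1
    rw [← neg_sub, h4, neg_neg]
  · refine squeeze_zero_norm' (a := fun t => 1 * Real.exp (-ε * t)) ?_ ?_
    · filter_upwards [eventually_ge_atTop 0] with t ht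
      exact norm_exp_smul_le (hA t ht)
    · simp only [one_mul]
      exact Real.tendsto_exp_atBot.comp (tendsto_id.const_mul_atTop_of_neg (neg_lt_zero.2 hε))

end Abel

/-! ### The Abel average of a state -/

namespace LocalLindbladian

theorem norm_evolution_le (L : LocalLindbladian Λ R I N) {ρ : Op Λ} (hρ : IsState ρ) {t : ℝ}
    (ht : 0 ≤ t) : ‖L.evolution t ρ‖ ≤ 1 :=
  (L.traceLE_evolution ht hρ.traceLE).norm_le

theorem integrableOn_evolution (L : LocalLindbladian Λ R I N) {ρ : Op Λ} (hρ : IsState ρ) {ε : ℝ}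
    (hε : 0 < ε) : MeasureTheory.IntegrableOn
      (fun t : ℝ => (Real.exp (-t * ε) : ℂ) • L.evolution t ρ) (Set.Ioi 0) :=
  integrableOn_abel (G := L.lindbladian) hε fun _ ht => L.norm_evolution_le hρ ht

theorem norm_abelAverage_le (L : LocalLindbladian Λ R I N) {ρ : Op Λ} (hρ : IsState ρ) {ε : ℝ}
    (hε : 0 < ε) : ‖L.abelAverage ε ρ‖ ≤ 1 :=
  norm_abel_le (G := L.lindbladian) hε fun _ ht => L.norm_evolution_le hρ ht

theorem abelAverage_equation (L : LocalLindbladian Λ R I N) {ρ : Op Λ} (hρ : IsState ρ) {ε : ℝ}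
    (hε : 0 < ε) :
    (ε : ℂ) • L.abelAverage ε ρ - L.lindbladian (L.abelAverage ε ρ) = (ε : ℂ) • ρ := by
  have h1 := abel_sub_eq (G := L.lindbladian) hε fun _ ht => L.norm_evolution_le hρ ht
  have h2 := congrArg ((ε : ℂ) • ·) h1
  simp only [smul_sub] at h2
  rw [abelAverage, map_smul]
  exact h2

end LocalLindbladian

/-! ### Contour integrals of resolvents -/

/-- A closed rectifiable path, differentiable up to finitely many parameters. -/
structure IsLoop (η : ℝ → ℂ) : Prop where
  continuousOn : ContinuousOn η (Set.Icc 0 1)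
  closed : η 0 = η 1
  differentiable : ∃ s : Finset ℝ, ∀ t ∈ Set.Ioo (0 : ℝ) 1, t ∉ s → DifferentiableAt ℝ η t
  integrable : IntervalIntegrable (deriv η) MeasureTheory.volume 0 1

theorem IsContour.isLoop {γ : ℝ → ℂ} {U K : Set ℂ} (h : IsContour γ U K) : IsLoop γ :=
  ⟨h.continuousOn, h.closed, h.differentiable, h.integrable⟩

namespace IsLoop

variable {η : ℝ → ℂ}

theorem const_sub (h : IsLoop η) (c : ℂ) : IsLoop fun t => c - η t where
  continuousOn := continuousOn_const.sub h.continuousOn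
  closed := by rw [h.closed]
  differentiable := h.differentiable.imp fun s hs t ht hts => (hs t ht hts).const_sub c
  integrable := by
    have : deriv (fun t => c - η t) = -deriv η := by
      funext t; rw [deriv_const_sub]; rfl
    rw [this]
    exact h.integrable.neg

theorem intervalIntegrable_smul (h : IsLoop η) {E : Type*} [NormedAddCommGroup E] [NormedSpace ℂ E]
    {g : ℝ → E} (hg : ContinuousOn g (Set.Icc 0 1)) :
    IntervalIntegrable (fun t => deriv η t • g t) MeasureTheory.volume 0 1 :=
  h.integrable.smul_continuousOn (by rwa [Set.uIcc_of_le zero_le_one])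

/-- The integrand is the derivative of `F ∘ η` off finitely many parameters, and the loop is closed.
A primitive near the points of the path suffices, so no Cauchy theorem is needed. -/
theorem integral_eq_zero (h : IsLoop η) {F f : ℂ → ℂ}
    (hF : ∀ t ∈ Set.Icc (0 : ℝ) 1, HasDerivAt F (f (η t)) (η t))
    (hf : ContinuousOn (fun t => f (η t)) (Set.Icc 0 1)) :
    ∫ t in (0 : ℝ)..1, deriv η t * f (η t) = 0 := by
  obtain ⟨s, hs⟩ := h.differentiable
  have h1 := MeasureTheory.integral_eq_of_hasDerivAt_off_countable_of_le (fun t => F (η t))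
    (fun t => deriv η t * f (η t)) zero_le_one s.countable_toSet
    (fun t ht => (hF t ht).continuousAt.comp_continuousWithinAt (h.continuousOn t ht))
    (fun t ht => ?_) (h.intervalIntegrable_smul hf)
  · rw [h1, h.closed, sub_self]
  · have h2 := (hs t ht.1 ht.2).hasDerivAt
    rw [mul_comm]
    exact (hF t (Set.Ioo_subset_Icc_self ht.1)).comp_of_eq t h2 rfl

theorem integral_pow_inv_eq_zero (h : IsLoop η) {w : ℂ} (hw : ∀ t ∈ Set.Icc (0 : ℝ) 1, η t ≠ w)
    (m : ℕ) : ∫ t in (0 : ℝ)..1, deriv η t * ((η t - w)⁻¹) ^ (m + 2) = 0 := by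
  have hne : ∀ t ∈ Set.Icc (0 : ℝ) 1, η t - w ≠ 0 := fun t ht => sub_ne_zero.2 (hw t ht)
  refine h.integral_eq_zero (F := fun z => -((m : ℂ) + 1)⁻¹ * ((z - w)⁻¹) ^ (m + 1))
    (f := fun z => ((z - w)⁻¹) ^ (m + 2)) (fun t ht => ?_)
    (((h.continuousOn.sub continuousOn_const).inv₀ hne).pow _)
  have h1 := ((((hasDerivAt_id (η t)).sub_const w).inv (hne t ht)).pow (m + 1)).const_mul
    (-((m : ℂ) + 1)⁻¹)
  refine h1.congr_deriv ?_
  have h2 : (m : ℂ) + 1 ≠ 0 := by exact_mod_cast m.succ_ne_zero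
  have h3 := hne t ht
  simp only [Nat.cast_add, Nat.cast_one, add_tsub_cancel_right, Pi.inv_apply, id, inv_pow]
  field_simp
  ring

theorem integral_inv_eq_zero (h : IsLoop η) {w : ℂ}
    (hw : ∀ t ∈ Set.Icc (0 : ℝ) 1, w.re < (η t).re) :
    ∫ t in (0 : ℝ)..1, deriv η t * (η t - w)⁻¹ = 0 := by
  have hs : ∀ t ∈ Set.Icc (0 : ℝ) 1, η t - w ∈ Complex.slitPlane := fun t ht =>
    Or.inl (by simpa using hw t ht)
  -- The path stays in the open half-plane to the right of `w`, where the principal logarithm is a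
  -- primitive.
  refine h.integral_eq_zero (F := fun z => Complex.log (z - w)) (f := fun z => (z - w)⁻¹)
    (fun t ht => ?_) ((h.continuousOn.sub continuousOn_const).inv₀ fun t ht =>
      Complex.slitPlane_ne_zero (hs t ht))
  have h1 := ((hasDerivAt_id (η t)).sub_const w).clog (hs t ht)
  simpa using h1

variable {V : Type*} [NormedAddCommGroup V] [NormedSpace ℂ V]

theorem resolvent_mul_sub {D : V →L[ℂ] V} {z : ℂ} (hz : z ∉ spectrum ℂ D) (v : V) :
    resolvent D z (z • v - D v) = v := by
  have h1 := Ring.inverse_mul_cancel _ (not_not.1 hz : IsUnit (algebraMap ℂ (V →L[ℂ] V) z - D))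
  have h2 := congrArg (fun T : V →L[ℂ] V => T v) h1
  simpa [resolvent, Algebra.algebraMap_eq_smul_one] using h2

theorem sub_mul_resolvent {D : V →L[ℂ] V} {z : ℂ} (hz : z ∉ spectrum ℂ D) (v : V) :
    z • resolvent D z v - D (resolvent D z v) = v := by
  have h1 := Ring.mul_inverse_cancel _ (not_not.1 hz : IsUnit (algebraMap ℂ (V →L[ℂ] V) z - D))
  have h2 := congrArg (fun T : V →L[ℂ] V => T v) h1
  simpa [resolvent, Algebra.algebraMap_eq_smul_one] using h2

variable [CompleteSpace V]

theorem continuousOn_resolvent (h : IsLoop η) {D : V →L[ℂ] V}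
    (hD : ∀ t ∈ Set.Icc (0 : ℝ) 1, η t ∉ spectrum ℂ D) :
    ContinuousOn (fun t => resolvent D (η t)) (Set.Icc 0 1) := fun t ht =>
  (spectrum.hasDerivAt_resolvent_const_left
    (not_not.1 (hD t ht))).continuousAt.comp_continuousWithinAt (h.continuousOn t ht)

/-- With `v' = (D - w) v` one has `(z - w) R(z) v = v + R(z) v'`. Each use raises the pole order by
one and lowers the nilpotency index, so only the simple pole, present for `m = 0`, contributes. The
exponent `m` must be general for this induction. -/
theorem integral_resolvent_genEigenspace (h : IsLoop η) {D : V →L[ℂ] V}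
    (hD : ∀ t ∈ Set.Icc (0 : ℝ) 1, η t ∉ spectrum ℂ D) {w : ℂ}
    (hw : ∀ t ∈ Set.Icc (0 : ℝ) 1, η t ≠ w) (k m : ℕ) (v : V)
    (hv : (((D : V →ₗ[ℂ] V) - algebraMap ℂ (Module.End ℂ V) w) ^ k) v = 0) :
    ∫ t in (0 : ℝ)..1, deriv η t • ((η t - w)⁻¹) ^ m • resolvent D (η t) v =
      if m = 0 then (∫ t in (0 : ℝ)..1, deriv η t * (η t - w)⁻¹) • v else 0 := by
  have hne : ∀ t ∈ Set.Icc (0 : ℝ) 1, η t - w ≠ 0 := fun t ht => sub_ne_zero.2 (hw t ht)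
  have hc : ∀ m, ContinuousOn (fun t => ((η t - w)⁻¹) ^ m) (Set.Icc 0 1) := fun m =>
    ((h.continuousOn.sub continuousOn_const).inv₀ hne).pow m
  have hR := h.continuousOn_resolvent hD
  induction k generalizing m v with
  | zero =>
    have : v = 0 := by simpa using hv
    simp [this]
  | succ k ih =>
    set v' : V := ((D : V →ₗ[ℂ] V) - algebraMap ℂ (Module.End ℂ V) w) v with hv'
    have h1 := ih (m + 1) v' (by rw [pow_succ] at hv; exact hv)
    rw [if_neg (Nat.succ_ne_zero m)] at h1
    have hv2 : v' = D v - w • v := by simp [hv', Algebra.algebraMap_eq_smul_one]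
    have h2 : Set.EqOn (fun t => deriv η t • ((η t - w)⁻¹) ^ m • resolvent D (η t) v)
        (fun t => deriv η t • ((η t - w)⁻¹) ^ (m + 1) • v +
          deriv η t • ((η t - w)⁻¹) ^ (m + 1) • resolvent D (η t) v') (Set.uIcc 0 1) := by
      intro t ht
      rw [Set.uIcc_of_le zero_le_one] at ht
      have h3 := resolvent_mul_sub (hD t ht) v
      have h4 : v + resolvent D (η t) v' = (η t - w) • resolvent D (η t) v := by
        have h5 : η t • v - D v = (η t - w) • v - v' := by rw [hv2, sub_smul]; abel
        rw [h5, map_sub, map_smul] at h3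
        rw [← eq_sub_iff_add_eq]
        exact h3.symm
      simp only
      rw [← smul_add, ← smul_add, h4, smul_smul _ (η t - w), pow_succ,
        inv_mul_cancel_right₀ (hne t ht)]
    rw [intervalIntegral.integral_congr h2, intervalIntegral.integral_add
      (h.intervalIntegrable_smul (g := fun t => ((η t - w)⁻¹) ^ (m + 1) • v)
        ((hc (m + 1)).smul continuousOn_const))
      (h.intervalIntegrable_smul (g := fun t => ((η t - w)⁻¹) ^ (m + 1) • resolvent D (η t) v')
        ((hc (m + 1)).smul (hR.clm_apply continuousOn_const))), h1,
      add_zero]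
    simp only [smul_smul]
    rw [intervalIntegral.integral_smul_const]
    rcases m with _ | m
    · simp
    · rw [h.integral_pow_inv_eq_zero hw m]
      simp

/-- The generalized eigenspaces span a finite-dimensional complex space, and both sides are linear
in `v`. The common value `c` is `2πi` for the contour itself and `0` for its reflection. -/
theorem integral_resolvent [FiniteDimensional ℂ V] (h : IsLoop η) {D : V →L[ℂ] V}
    (hD : ∀ t ∈ Set.Icc (0 : ℝ) 1, η t ∉ spectrum ℂ D) {c : ℂ}
    (hc : ∀ w ∈ spectrum ℂ D, ∫ t in (0 : ℝ)..1, deriv η t * (η t - w)⁻¹ = c) (v : V) :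
    ∫ t in (0 : ℝ)..1, deriv η t • resolvent D (η t) v = c • v := by
  have hR := h.continuousOn_resolvent hD
  have hmem : v ∈ ⨆ w, Module.End.maxGenEigenspace (D : V →ₗ[ℂ] V) w := by
    rw [Module.End.iSup_maxGenEigenspace_eq_top]
    trivial
  refine Submodule.iSup_induction _ (motive := fun v =>
    ∫ t in (0 : ℝ)..1, deriv η t • resolvent D (η t) v = c • v) hmem (fun w v hv => ?_) (by simp)
    fun v v' hv hv' => ?_
  · by_cases hv0 : v = 0
    · simp [hv0]
    obtain ⟨k, hk⟩ := (Module.End.mem_maxGenEigenspace _ _ _).1 hv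
    -- Otherwise `D - w` is injective, and so are its powers, against `v ≠ 0`.
    have hw : w ∈ spectrum ℂ D := by
      by_contra hu
      have h0 : ∀ u, ((D : V →ₗ[ℂ] V) - w • 1) u = 0 → u = 0 := fun u h => by
        have h1 := resolvent_mul_sub hu u
        have h2 : w • u - D u = 0 := by
          rw [← neg_sub, neg_eq_zero]
          simpa using h
        rw [← h1, h2, map_zero]
      have h1 : ∀ k : ℕ, (((D : V →ₗ[ℂ] V) - w • 1) ^ k) v ≠ 0 := fun k => by
        induction k with
        | zero => simpa using hv0
        | succ k ih => rw [pow_succ']; exact fun h => ih (h0 _ h)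
      exact h1 k hk
    have h1 := h.integral_resolvent_genEigenspace hD (w := w)
      (fun t ht e => hD t ht (e ▸ hw)) k 0 v (by simpa [Algebra.algebraMap_eq_smul_one] using hk)
    rw [if_pos rfl, hc w hw] at h1
    simpa using h1
  · simp only [map_add, smul_add]
    rw [intervalIntegral.integral_add
      (h.intervalIntegrable_smul (hR.clm_apply continuousOn_const))
      (h.intervalIntegrable_smul (hR.clm_apply continuousOn_const)), hv, hv']

/-- A solution `W` of the Sylvester equation `ε W - D W - W D' = Y` is a contour integral. -/
theorem integral_sylvester [FiniteDimensional ℂ V] {V' : Type*} [NormedAddCommGroup V']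
    [NormedSpace ℂ V'] [CompleteSpace V'] [FiniteDimensional ℂ V'] (h : IsLoop η)
    {D : V →L[ℂ] V} {D' : V' →L[ℂ] V'} {ε : ℝ}
    (hη : ∀ t ∈ Set.Icc (0 : ℝ) 1, (η t).re < ε ∧ η t ∉ spectrum ℂ D)
    (hc : ∀ w ∈ spectrum ℂ D, ∫ t in (0 : ℝ)..1, deriv η t * (η t - w)⁻¹ = 2 * Real.pi * Complex.I)
    (hD' : ∀ w ∈ spectrum ℂ D', w.re ≤ 0) {W Y : V' →L[ℂ] V}
    (hY : ∀ v, Y v = (ε : ℂ) • W v - D (W v) - W (D' v)) (v : V') :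
    ∫ t in (0 : ℝ)..1, deriv η t • resolvent D (η t) (Y (resolvent D' (ε - η t) v)) =
      (2 * Real.pi * Complex.I) • W v := by
  have hl := h.const_sub (ε : ℂ)
  have hpos : ∀ t ∈ Set.Icc (0 : ℝ) 1, 0 < ((ε : ℂ) - η t).re := fun t ht => by
    simpa using (hη t ht).1
  have hσ' : ∀ t ∈ Set.Icc (0 : ℝ) 1, (ε : ℂ) - η t ∉ spectrum ℂ D' := fun t ht hs =>
    (hD' _ hs).not_gt (hpos t ht)
  have h1 := h.integral_resolvent (fun t ht => (hη t ht).2) hc (W v)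
  -- The reflected path `ε - η` lies in the right half-plane, the spectrum of `D'` in the closed
  -- left one, so every winding integral vanishes.
  have h2 := hl.integral_resolvent hσ' (c := 0)
    (fun w hw => hl.integral_inv_eq_zero fun t ht => (hD' w hw).trans_lt (hpos t ht)) v
  have hR := h.continuousOn_resolvent fun t ht => (hη t ht).2
  have hR' := hl.continuousOn_resolvent hσ'
  have h3 : Set.EqOn (fun t => deriv η t • resolvent D (η t) (Y (resolvent D' (ε - η t) v)))
      (fun t => deriv η t • W (resolvent D' (ε - η t) v) + deriv η t • resolvent D (η t) (W v))
      (Set.uIcc 0 1) := by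
    intro t ht
    rw [Set.uIcc_of_le zero_le_one] at ht
    set f := resolvent D' (ε - η t) v with hf
    have h4 : ((ε : ℂ) - η t) • f - D' f = v := sub_mul_resolvent (hσ' t ht) v
    -- This is `Y = (z - D) W + W (ε - z - D')` evaluated at `f = (ε - z - D')⁻¹ v`.
    have h5 : Y f = (η t • W f - D (W f)) + W v := by
      rw [hY, ← h4, map_sub, map_smul, sub_smul]
      abel
    simp only
    rw [← hf, h5, map_add, resolvent_mul_sub (hη t ht).2, smul_add]
  rw [intervalIntegral.integral_congr h3, intervalIntegral.integral_add
    (h.intervalIntegrable_smul (g := fun t => W (resolvent D' (ε - η t) v)) (W.continuous.comp_continuousOn (hR'.clm_apply continuousOn_const)))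
    (h.intervalIntegrable_smul (hR.clm_apply continuousOn_const)), h1]
  have h6 : (fun t => deriv η t • W (resolvent D' (ε - η t) v)) =
      fun t => W (deriv η t • resolvent D' (ε - η t) v) := by
    funext t; rw [map_smul]
  have h7 := h.intervalIntegrable_smul (hR'.clm_apply (continuousOn_const (c := v)))
  rw [h6, W.intervalIntegral_comp_comm h7]
  have h8 : ∫ t in (0 : ℝ)..1, deriv η t • resolvent D' (ε - η t) v = 0 := by
    simp only [deriv_const_sub, neg_smul, zero_smul] at h2
    rw [intervalIntegral.integral_neg] at h2
    exact neg_eq_zero.1 h2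
  rw [h8, map_zero, zero_add]

end IsLoop

/-! ### Block structure of the Lindbladian -/

namespace LocalLindbladian

/-- Off the support `G_Z^*` and all `L_α^*` annihilate `δ_v`, which removes the sandwiches and the
right multiplication. -/
theorem inner_term_of_right_notMem (L : LocalLindbladian Λ R I N) {Z : Set Λ} {v : Λ}
    (hv : v ∉ L.termSupport Z) (σ : Op Λ) (φ : ell2 Λ) :
    ⟪φ, L.term Z σ (delta v)⟫ = ⟪φ, L.effTerm Z (σ (delta v))⟫ := by
  have h1 : ∀ α, star (L.jump Z α) (delta v) = 0 := fun α =>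
    apply_delta_eq_zero ((opSupport_star_subset _).trans (L.jump_support' Z α)) hv
  rw [term_eq]
  simp [h1, L.star_effTerm_apply_delta hv]

theorem inner_term_of_left_notMem (L : LocalLindbladian Λ R I N) {Z : Set Λ} {u : Λ}
    (hu : u ∉ L.termSupport Z) (σ : Op Λ) (ψ : ell2 Λ) :
    ⟪delta u, L.term Z σ ψ⟫ = ⟪delta u, σ (star (L.effTerm Z) ψ)⟫ := by
  have h1 : ∀ α, star (L.jump Z α) (delta u) = 0 := fun α =>
    apply_delta_eq_zero ((opSupport_star_subset _).trans (L.jump_support' Z α)) hu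
  rw [term_eq]
  simp [← inner_star_left (L.jump Z _), h1,
    ← inner_star_left (L.effTerm Z), L.star_effTerm_apply_delta hu]

theorem inner_term_of_notMem (L : LocalLindbladian Λ R I N) {Z : Set Λ} {u v : Λ}
    (hu : u ∉ L.termSupport Z) (hv : v ∉ L.termSupport Z) (σ : Op Λ) :
    ⟪delta u, L.term Z σ (delta v)⟫ = 0 := by
  rw [L.inner_term_of_left_notMem hu, L.star_effTerm_apply_delta hv, map_zero, inner_zero_right]

theorem restrict_term_of_mem (L : LocalLindbladian Λ R I N) {P : Set (Set Λ)} {Z : Set Λ}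
    (hZ : Z ∈ P) (ρ : Op Λ) : (L.restrict P).term Z ρ = L.term Z ρ := by
  simp [term, restrict, hZ]
  rfl

theorem restrict_term_of_notMem (L : LocalLindbladian Λ R I N) {P : Set (Set Λ)} {Z : Set Λ}
    (hZ : Z ∉ P) (ρ : Op Λ) : (L.restrict P).term Z ρ = 0 := by
  simp [term, restrict, hZ]

theorem restrict_effTerm_of_mem (L : LocalLindbladian Λ R I N) {P : Set (Set Λ)} {Z : Set Λ}
    (hZ : Z ∈ P) : (L.restrict P).effTerm Z = L.effTerm Z := by
  simp [effTerm, restrict, hZ]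
  rfl

theorem restrict_effTerm_of_notMem (L : LocalLindbladian Λ R I N) {P : Set (Set Λ)} {Z : Set Λ}
    (hZ : Z ∉ P) : (L.restrict P).effTerm Z = 0 := by
  simp [effTerm, restrict, hZ]

theorem effective_congr {L M : LocalLindbladian Λ R I N} (h : ∀ Z, L.effTerm Z = M.effTerm Z) :
    L.effective = M.effective := congrArg wotSum (funext h)

/-- All terms belonging to `Z` vanish. -/
def Vanishes (L : LocalLindbladian Λ R I N) (Z : Set Λ) : Prop :=
  L.h Z = 0 ∧ ∀ α, L.jump Z α = 0

theorem vanishes_of_diam (L : LocalLindbladian Λ R I N) {Z : Set Λ} (hZ : ¬ diam Z ≤ R) :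
    L.Vanishes Z := ⟨L.h_eq_zero Z (not_le.1 hZ), fun α => L.jump_eq_zero Z α (not_le.1 hZ)⟩

theorem restrict_vanishes_of_notMem (L : LocalLindbladian Λ R I N) {P : Set (Set Λ)} {Z : Set Λ}
    (hZ : Z ∉ P) : (L.restrict P).Vanishes Z := ⟨if_neg hZ, fun _ => if_neg hZ⟩

theorem Vanishes.effTerm {L : LocalLindbladian Λ R I N} {Z : Set Λ} (h : L.Vanishes Z) :
    L.effTerm Z = 0 := by
  simp [LocalLindbladian.effTerm, h.1, h.2]

theorem Vanishes.term {L : LocalLindbladian Λ R I N} {Z : Set Λ} (h : L.Vanishes Z) (ρ : Op Λ) :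
    L.term Z ρ = 0 := by
  simp [LocalLindbladian.term, h.1, h.2]

theorem Vanishes.notMem_termSupport {L : LocalLindbladian Λ R I N} {Z : Set Λ}
    (h : L.Vanishes Z) (u : Λ) : u ∉ L.termSupport Z := by
  simp [termSupport, h.1, h.2, opSupport]

theorem inner_effTerm_of_notMem (L : LocalLindbladian Λ R I N) {Z : Set Λ} {u : Λ}
    (hu : u ∉ L.termSupport Z) (φ : ell2 Λ) : ⟪delta u, L.effTerm Z φ⟫ = 0 := by
  rw [← inner_star_left, L.star_effTerm_apply_delta hu, inner_zero_left]

theorem inner_lindbladian_eq_zero (L : LocalLindbladian Λ R I N) {u v : Λ}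
    (h : ∀ Z, u ∉ L.termSupport Z ∧ v ∉ L.termSupport Z) (σ : Op Λ) :
    ⟪delta u, L.lindbladian σ (delta v)⟫ = 0 := by
  refine (L.hasSum_inner_lindbladian σ (delta u) (delta v)).unique ?_
  simp only [fun Z => L.inner_term_of_notMem (h Z).1 (h Z).2 σ]
  exact hasSum_zero

theorem inner_lindbladian_restrict (L : LocalLindbladian Λ R I N) (P : Set (Set Λ)) (σ : Op Λ)
    (φ ψ : ell2 Λ) : ⟪φ, L.lindbladian σ ψ⟫ =
      ⟪φ, (L.restrict P).lindbladian σ ψ⟫ + ⟪φ, (L.restrict Pᶜ).lindbladian σ ψ⟫ := by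
  refine (L.hasSum_inner_lindbladian σ φ ψ).unique ((((L.restrict P).hasSum_inner_lindbladian
    σ φ ψ).add ((L.restrict Pᶜ).hasSum_inner_lindbladian σ φ ψ)).congr_fun fun Z => ?_)
  by_cases hZ : Z ∈ P
  · rw [restrict_term_of_mem L hZ, restrict_term_of_notMem L (P := Pᶜ) (fun h => h hZ)]; simp
  · rw [restrict_term_of_notMem L hZ, restrict_term_of_mem L (P := Pᶜ) hZ]; simp

/-- Off-diagonal blocks of a Lindbladian whose terms respect the decomposition into `S`, `T` and
the rest. -/
theorem inner_lindbladian_block (M : LocalLindbladian Λ R I N) {S T : Set Λ} (hST : Disjoint S T)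
    (hM : ∀ Z, M.Vanishes Z ∨ Z ⊆ S ∨ Z ⊆ T ∨ Z ⊆ (S ∪ T)ᶜ) {u v : Λ} (hu : u ∈ S) (hv : v ∈ T)
    (σ : Op Λ) : ⟪delta u, M.lindbladian σ (delta v)⟫ =
      ⟪delta u, (M.restrict {Z | Z ⊆ S}).effective (σ (delta v))⟫ +
        ⟪delta u, σ (star (M.restrict {Z | Z ⊆ T}).effective (delta v))⟫ := by
  have huT : u ∉ T := fun h => hST.notMem_of_mem_left hu h
  have hvS : v ∉ S := fun h => hST.notMem_of_mem_left h hv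
  refine (M.hasSum_inner_lindbladian σ (delta u) (delta v)).unique
    ((((M.restrict {Z | Z ⊆ S}).hasSum_inner_effective _ _).add
      ((M.restrict {Z | Z ⊆ T}).hasSum_inner_star_effective σ _ _)).congr_fun fun Z => ?_)
  have e1 : u ∉ M.termSupport Z → ⟪delta u, (M.restrict {Z | Z ⊆ S}).effTerm Z (σ (delta v))⟫ = 0 :=
    fun h => by
      by_cases hZ : Z ⊆ S
      · rw [restrict_effTerm_of_mem M (P := {Z | Z ⊆ S}) hZ, M.inner_effTerm_of_notMem h]
      · rw [restrict_effTerm_of_notMem M (P := {Z | Z ⊆ S}) hZ]; simp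
  have e2 : v ∉ M.termSupport Z →
      ⟪delta u, σ (star ((M.restrict {Z | Z ⊆ T}).effTerm Z) (delta v))⟫ = 0 :=
    fun h => by
      by_cases hZ : Z ⊆ T
      · rw [restrict_effTerm_of_mem M (P := {Z | Z ⊆ T}) hZ, M.star_effTerm_apply_delta h]; simp
      · rw [restrict_effTerm_of_notMem M (P := {Z | Z ⊆ T}) hZ]; simp
  have e3 : u ∉ M.termSupport Z → v ∉ M.termSupport Z →
      ⟪delta u, M.term Z σ (delta v)⟫ =
        ⟪delta u, (M.restrict {Z | Z ⊆ S}).effTerm Z (σ (delta v))⟫ +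
        ⟪delta u, σ (star ((M.restrict {Z | Z ⊆ T}).effTerm Z) (delta v))⟫ := fun h h' => by
    rw [e1 h, e2 h', M.inner_term_of_notMem h h', add_zero]
  have hsub := M.termSupport_subset Z
  -- A set inside `S` misses `v`, so only left multiplication survives; a set inside `T` misses `u`,
  -- so only right multiplication does. In the two outer cases neither site is touched.
  rcases hM Z with h | h | h | h
  · exact e3 (h.notMem_termSupport u) (h.notMem_termSupport v)
  · have h' : v ∉ M.termSupport Z := fun h' => hvS (h (hsub h'))
    rw [e2 h', M.inner_term_of_right_notMem h', restrict_effTerm_of_mem M (P := {Z | Z ⊆ S}) h,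
      add_zero]
  · have h' : u ∉ M.termSupport Z := fun h' => huT (h (hsub h'))
    rw [e1 h', M.inner_term_of_left_notMem h', restrict_effTerm_of_mem M (P := {Z | Z ⊆ T}) h,
      zero_add]
  · exact e3 (fun h' => h (hsub h') (Or.inl hu)) (fun h' => h (hsub h') (Or.inr hv))

end LocalLindbladian

/-! ### Geometry of the boxes -/

theorem gdist_self (u : Λ) : gdist u u = 0 := SimpleGraph.edist_self

theorem gdist_comm (u v : Λ) : gdist u v = gdist v u := SimpleGraph.edist_comm

theorem gdist_triangle (u v w : Λ) : gdist u w ≤ gdist u v + gdist v w :=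
  SimpleGraph.edist_triangle

/-- Otherwise the path `x, u, v, y` would have length less than `d(x,y)`: two legs are at most a
third of it, and the middle one, at most `R`, is strictly less than a third. -/
theorem lt_gdist_of_mem_box {x y u v : Λ} (hR : ((3 * R : ℕ) : ℕ∞) < gdist x y)
    (hfin : gdist x y ≠ ⊤) (hu : u ∈ box x y) (hv : v ∈ box y x) : (R : ℕ∞) < gdist u v := by
  by_contra! h
  have hu' : 3 * gdist x u ≤ gdist x y := hu
  have hv' : 3 * gdist y v ≤ gdist y x := hv
  have h1 := gdist_triangle x u y
  have h2 := gdist_triangle u v y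
  rw [gdist_comm y x, gdist_comm y v] at hv'
  obtain ⟨n, hn⟩ := ENat.ne_top_iff_exists.1 hfin
  rw [← hn] at hR hu' hv' h1
  have ha : gdist x u ≠ ⊤ := fun h => by rw [h] at hu'; simp at hu'
  have hb : gdist v y ≠ ⊤ := fun h => by rw [h] at hv'; simp at hv'
  have hc : gdist u v ≠ ⊤ := fun h' => by rw [h'] at h; simp at h
  obtain ⟨a, ha⟩ := ENat.ne_top_iff_exists.1 ha
  obtain ⟨b, hb⟩ := ENat.ne_top_iff_exists.1 hb
  obtain ⟨c, hc⟩ := ENat.ne_top_iff_exists.1 hc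
  have h3 := h1.trans (add_le_add_right h2 _)
  rw [← ha, ← hb, ← hc] at h3
  clear h1 h2 hfin hn
  rw [← ha] at hu'
  rw [← hb] at hv'
  rw [← hc] at h
  norm_cast at hR hu' hv' h h3
  omega

theorem disjoint_box {x y : Λ} (hR : ((3 * R : ℕ) : ℕ∞) < gdist x y) (hfin : gdist x y ≠ ⊤) :
    Disjoint (box x y) (box y x) := by
  refine Set.disjoint_left.2 fun u hu hv => ?_
  have := lt_gdist_of_mem_box hR hfin hu hv
  rw [gdist_self] at this
  exact not_lt_zero this

theorem subset_box_of_diam {x y : Λ} (hR : ((3 * R : ℕ) : ℕ∞) < gdist x y) (hfin : gdist x y ≠ ⊤)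
    {Z : Set Λ} (hZ : Z ⊆ twoBoxes x y) (hd : diam Z ≤ R) : Z ⊆ box x y ∨ Z ⊆ box y x := by
  by_contra! h
  obtain ⟨⟨u, hu, hu'⟩, ⟨v, hv, hv'⟩⟩ := Set.not_subset.1 h.1, Set.not_subset.1 h.2
  exact (lt_gdist_of_mem_box hR hfin ((hZ hv).resolve_right hv') ((hZ hu).resolve_left hu')).not_ge
    ((gdist_le_diam hv hu).trans hd)

theorem setDist_le_iff {δ : Λ → Λ → ℕ∞} {Z Z' : Set Λ} {r : ℕ} :
    setDist δ Z Z' ≤ r ↔ ∃ u ∈ Z, ∃ v ∈ Z', δ u v ≤ r := by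
  constructor
  · intro h
    -- Distances are integers or `⊤`, so `≤ r` becomes the strict bound `< r + 1`, which some pair
    -- of points must satisfy.
    have h1 : setDist δ Z Z' < r + 1 := ENat.lt_add_one_iff (ENat.natCast_ne_top r) |>.2 h
    simp only [setDist, iInf_lt_iff] at h1
    obtain ⟨u, hu, v, hv, h2⟩ := h1
    exact ⟨u, hu, v, hv, (ENat.lt_add_one_iff (ENat.natCast_ne_top r)).1 h2⟩
  · rintro ⟨u, hu, v, hv, h⟩
    exact (iInf₂_le_of_le u hu (iInf₂_le v hv)).trans h

theorem mem_rBoundary_iff {δ : Λ → Λ → ℕ∞} {S : Set Λ} {r : ℕ} {u : Λ} :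
    u ∈ rBoundary δ r S ↔ (∃ v ∈ S, δ u v ≤ r) ∧ ∃ v ∈ Sᶜ, δ u v ≤ r := by
  change max _ _ ≤ (r : ℕ∞) ↔ _
  simp only [max_le_iff, setDist_le_iff, Set.mem_singleton_iff, exists_eq_left]

theorem ambientDist_le_gdist (u v : Λ) : ambientDist u v ≤ gdist u v := by
  by_cases h : gdist u v = ⊤
  · rw [h]; exact le_top
  · obtain ⟨p, hp⟩ := SimpleGraph.exists_walk_of_edist_ne_top h
    rw [gdist, ← hp, ambientDist]
    have := SimpleGraph.edist_le (p.map (SimpleGraph.Embedding.induce Λ).toHom)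
    rwa [SimpleGraph.Walk.length_map] at this

theorem le_gdist {δ : Λ → Λ → ℕ∞} (hδ : δ = ambientDist ∨ δ = gdist) (u v : Λ) :
    δ u v ≤ gdist u v := by
  rcases hδ with rfl | rfl
  · exact ambientDist_le_gdist u v
  · exact le_rfl

theorem ambientDist_le {δ : Λ → Λ → ℕ∞} (hδ : δ = ambientDist ∨ δ = gdist) (u v : Λ) :
    ambientDist u v ≤ δ u v := by
  rcases hδ with rfl | rfl
  · exact le_rfl
  · exact ambientDist_le_gdist u v

/-- A point of `S` close to the complement of a set containing `S` lies in the boundary of `S`. -/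
theorem mem_rBoundary_of_mem {δ : Λ → Λ → ℕ∞} (hδ : δ = ambientDist ∨ δ = gdist) {S : Set Λ}
    {r : ℕ} {u w : Λ} (hu : u ∈ S) (hw : w ∉ S) (h : δ u w ≤ r) : u ∈ rBoundary δ r S := by
  refine mem_rBoundary_iff.2 ⟨⟨u, hu, ?_⟩, w, hw, h⟩
  refine (le_gdist hδ u u).trans ?_
  rw [gdist_self]; exact zero_le

/-! ### Compressions -/

section Compress

variable {S T : Set Λ}

theorem coe_deltaOn (u : S) : (deltaOn S u : ell2 Λ) = delta (u : Λ) := rfl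

theorem inner_deltaOn (u : S) (f : ell2On S) : ⟪deltaOn S u, f⟫ = (f : ell2 Λ) u :=
  inner_delta (u : Λ) (f : ell2 Λ)

theorem inner_smul_on (f g : ell2On S) (c : ℂ) : ⟪f, c • g⟫ = c * ⟪f, g⟫ :=
  inner_smul_right f g c

theorem inner_sub_on (f g g' : ell2On S) : ⟪f, g - g'⟫ = ⟪f, g⟫ - ⟪f, g'⟫ :=
  inner_sub_right f g g'

theorem inner_sum_on {ι : Type*} (F : Finset ι) (f : ell2On S) (g : ι → ell2On S) :
    ⟪f, ∑ i ∈ F, g i⟫ = ∑ i ∈ F, ⟪f, g i⟫ :=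
  inner_sum F g f

theorem inner_compress (A : Op Λ) (f g : ell2On S) :
    ⟪f, compress S A g⟫ = ⟪(f : ell2 Λ), A g⟫ :=
  (ell2On S).inner_orthogonalProjectionOnto_eq_of_mem_left f (A g)

theorem star_compress (A : Op Λ) : star (compress S A) = compress S (star A) := by
  refine ContinuousLinearMap.ext fun g => ext_inner_left ℂ fun f => ?_
  rw [inner_compress, ContinuousLinearMap.star_eq_adjoint, ContinuousLinearMap.adjoint_inner_right,
    inner_star, ← inner_conj_symm, inner_compress, inner_conj_symm]

/-- The block of an operator mapping `ℓ²(T)` to `ℓ²(S)`. -/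
noncomputable def block (S T : Set Λ) (A : Op Λ) : ell2On T →L[ℂ] ell2On S :=
  (ell2On S).orthogonalProjectionOnto ∘L A ∘L (ell2On T).subtypeL

theorem inner_block (A : Op Λ) (f : ell2On S) (g : ell2On T) :
    ⟪f, block S T A g⟫ = ⟪(f : ell2 Λ), A g⟫ :=
  (ell2On S).inner_orthogonalProjectionOnto_eq_of_mem_left f (A g)

/-- Projecting `σ g` to `ℓ²(S)` before applying `E` loses nothing, because `E^* δ_u` already lives
on `S`. -/
theorem inner_compress_block {E : Op Λ} {u : S} (hE : star E (delta (u : Λ)) ∈ ell2On S)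
    (σ : Op Λ) (g : ell2On T) :
    ⟪deltaOn S u, compress S E (block S T σ g)⟫ = ⟪delta (u : Λ), E (σ g)⟫ := by
  rw [inner_compress, coe_deltaOn, ← inner_star_left, ← inner_star_left]
  exact inner_block σ ⟨_, hE⟩ g

theorem inner_block_star_compress {E : Op Λ} {v : T} (hE : star E (delta (v : Λ)) ∈ ell2On T)
    (σ : Op Λ) (f : ell2On S) :
    ⟪f, block S T σ (star (compress T E) (deltaOn T v))⟫ =
      ⟪(f : ell2 Λ), σ (star E (delta (v : Λ)))⟫ := by
  rw [inner_block, star_compress]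
  have h1 : (compress T (star E) (deltaOn T v) : ell2 Λ) = star E (delta (v : Λ)) :=
    congrArg Subtype.val
      ((ell2On T).orthogonalProjectionOnto_mem_subspace_eq_self ⟨star E (delta (v : Λ)), hE⟩)
  rw [h1]

theorem eq_sum_deltaOn [Fintype S] (f : ell2On S) :
    f = ∑ u, ⟪deltaOn S u, f⟫ • deltaOn S u := by
  classical
  refine Subtype.ext (lp.ext (funext fun w => ?_))
  have h2 : ∀ u w : Λ, (delta u : ell2 Λ) w = if w = u then 1 else 0 := fun u w => by
    by_cases h : w = u
    · subst h; simp [delta]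
    · rw [delta, lp.single_apply_ne 2 u _ h, if_neg h]
  rw [Submodule.coe_sum, lp.coeFn_sum, Finset.sum_apply]
  simp only [Submodule.coe_smul, coe_deltaOn, lp.coeFn_smul, Pi.smul_apply, smul_eq_mul, h2,
    inner_deltaOn]
  by_cases hw : w ∈ S
  · rw [Finset.sum_eq_single ⟨w, hw⟩]
    · simp
    · intro u _ hu
      rw [if_neg fun h => hu (Subtype.ext h.symm), mul_zero]
    · simp
  · rw [f.2 w hw, Finset.sum_eq_zero]
    intro u _
    rw [if_neg fun h : w = u => hw (h ▸ u.2), mul_zero]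

theorem finiteDimensional_ell2On (hS : S.Finite) : FiniteDimensional ℂ (ell2On S) := by
  have := hS.fintype
  refine Module.Finite.of_surjective (Fintype.linearCombination ℂ (deltaOn S)) fun f => ?_
  exact ⟨fun u => ⟪deltaOn S u, f⟫, (eq_sum_deltaOn f).symm⟩

/-- Expansion of a matrix element of a product in the canonical bases. -/
theorem inner_comp_eq_sum [Fintype S] [Fintype T] (A : ell2On S →L[ℂ] ell2On S)
    (Y : ell2On T →L[ℂ] ell2On S) (f : ell2On S) (g : ell2On T) :
    ⟪f, A (Y g)⟫ = ∑ u, ∑ v, ⟪f, A (deltaOn S u)⟫ * ⟪deltaOn T v, g⟫ *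
      ⟪deltaOn S u, Y (deltaOn T v)⟫ := by
  conv_lhs => rw [eq_sum_deltaOn (Y g), map_sum, inner_sum_on]
  refine Finset.sum_congr rfl fun u _ => ?_
  rw [map_smul, inner_smul_on]
  conv_lhs => rw [eq_sum_deltaOn g]
  rw [map_sum, inner_sum_on, Finset.sum_mul]
  simp only [map_smul, inner_smul_on]
  exact Finset.sum_congr rfl fun v _ => by ring

end Compress

/-! ### Dissipative generators on a box -/

namespace LocalLindbladian

theorem star_effective_mem (L : LocalLindbladian Λ R I N) {S : Set Λ}
    (h : ∀ Z, L.termSupport Z ⊆ S) (φ : ell2 Λ) : star L.effective φ ∈ ell2On S := by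
  intro w hw
  rw [← inner_delta]
  refine ((L.hasSum_inner_star_effective 1 (delta w) φ).unique ?_)
  have h1 : ∀ Z, ⟪delta w, (1 : Op Λ) (star (L.effTerm Z) φ)⟫ = 0 := fun Z => by
    rw [one_apply_eq_self, inner_star, L.effTerm_apply_delta fun h' => hw (h Z h'), inner_zero_left]
  simp only [h1]
  exact hasSum_zero

theorem re_inner_effective_nonpos (L : LocalLindbladian Λ R I N) (ψ : ell2 Λ) :
    (⟪ψ, L.effective ψ⟫).re ≤ 0 := by
  have := (L.hasSum_norm_jump ψ).nonneg fun Z => by positivity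
  linarith

theorem termSupport_restrict_subset (L : LocalLindbladian Λ R I N) {P : Set (Set Λ)} {S : Set Λ}
    (hP : ∀ Z ∈ P, Z ⊆ S) (Z : Set Λ) : (L.restrict P).termSupport Z ⊆ S := by
  by_cases hZ : Z ∈ P
  · exact ((L.restrict P).termSupport_subset Z).trans (hP Z hZ)
  · exact fun u hu => absurd hu ((L.restrict_vanishes_of_notMem hZ).notMem_termSupport u)

end LocalLindbladian

/-- The operator on `ℓ²(Λ)` whose compression is `dissipativeGen`. -/
noncomputable def fullGen (L B : LocalLindbladian Λ R I N) (δ : Λ → Λ → ℕ∞) (Λ₁ S : Set Λ) : Op Λ :=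
  (L.restrict {Z | Z ⊆ S}).effective +
    (B.restrict {Z | Z ⊆ S ∧ Z ∈ innerBoundary δ R Λ₁}).effective

theorem star_fullGen_mem (L B : LocalLindbladian Λ R I N) (δ : Λ → Λ → ℕ∞) (Λ₁ S : Set Λ)
    (φ : ell2 Λ) : star (fullGen L B δ Λ₁ S) φ ∈ ell2On S := by
  rw [fullGen, star_add, add_apply]
  exact (ell2On S).add_mem
    ((L.restrict _).star_effective_mem (L.termSupport_restrict_subset fun Z hZ => hZ) φ)
    ((B.restrict _).star_effective_mem (B.termSupport_restrict_subset fun Z hZ => hZ.1) φ)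

/-- On a finite box `w` has an eigenvector `f` of `D^*`, and `Re w ‖f‖² = Re ⟪f, D f⟫ ≤ 0` by
dissipativity. -/
theorem re_le_zero_of_mem_spectrum {L B : LocalLindbladian Λ R I N} {δ : Λ → Λ → ℕ∞} {Λ₁ S : Set Λ}
    (hS : S.Finite) {w : ℂ} (hw : w ∈ spectrum ℂ (star (dissipativeGen L B δ Λ₁ S))) :
    w.re ≤ 0 := by
  have := finiteDimensional_ell2On hS
  set D := dissipativeGen L B δ Λ₁ S with hD
  have h1 : w ∈ spectrum ℂ ((star D : ell2On S →L[ℂ] ell2On S) : ell2On S →ₗ[ℂ] ell2On S) := by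
    rwa [← AlgEquiv.spectrum_eq (Module.End.toContinuousLinearMap (ell2On S))]
  obtain ⟨f, hf, hf0⟩ := (Module.End.hasEigenvalue_iff_mem_spectrum.2 h1).exists_hasEigenvector
  have h2 : star D f = w • f := Module.End.mem_eigenspace_iff.1 hf
  have h3 : (⟪f, star D f⟫).re ≤ 0 := by
    rw [ContinuousLinearMap.star_eq_adjoint, ContinuousLinearMap.adjoint_inner_right,
      ← inner_conj_symm, Complex.conj_re, hD, dissipativeGen, inner_compress, add_apply,
      inner_add_right, Complex.add_re]
    exact add_nonpos (LocalLindbladian.re_inner_effective_nonpos _ _)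
      (LocalLindbladian.re_inner_effective_nonpos _ _)
  have h7 : ⟪f, f⟫ = (‖f‖ : ℂ) ^ 2 := inner_self_eq_norm_sq_to_K f
  rw [h2, inner_smul_on, h7] at h3
  have h4 : 0 < ‖f‖ := norm_pos_iff.2 hf0
  have h5 : (w * ((‖f‖ : ℂ)) ^ 2).re = w.re * ‖f‖ ^ 2 := by
    rw [← Complex.ofReal_pow, Complex.re_mul_ofReal]
  have h6 : w.re * ‖f‖ ^ 2 ≤ 0 := h5 ▸ h3
  by_contra! h7
  nlinarith [mul_pos h7 (pow_pos h4 2)]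

/-! ### Boundary terms -/

section Boundary

variable {δ : Λ → Λ → ℕ∞} {x y : Λ} {L B₁ B₂ : LocalLindbladian Λ R I N}

/-- If `M` collects the non-crossing terms, then `ℒ = ℒ_∂ + M + ℬ_{Λ₁} + ℬ_{Λ₂}`. The terms of `M`
and `ℬ_{Λ₁}` respect the decomposition into the two boxes and the rest, so both have block form;
`ℬ_{Λ₂}` touches neither box. -/
theorem inner_lindbladian_eq (hR : ((3 * R : ℕ) : ℕ∞) < gdist x y) (hfin : gdist x y ≠ ⊤)
    (h₁ : B₁.IsBoundary δ (twoBoxes x y)) (h₂ : B₂.IsBoundary δ (twoBoxes x y)ᶜ) {u v : Λ}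
    (hu : u ∈ box x y) (hv : v ∈ box y x) (σ : Op Λ) :
    ⟪delta u, L.lindbladian σ (delta v)⟫ =
      ⟪delta u, L.boundaryOp B₁ B₂ (twoBoxes x y) σ (delta v)⟫ +
      (⟪delta u, fullGen L B₁ δ (twoBoxes x y) (box x y) (σ (delta v))⟫ +
        ⟪delta u, σ (star (fullGen L B₁ δ (twoBoxes x y) (box y x)) (delta v))⟫) := by
  have hdis := disjoint_box hR hfin
  set M := L.restrict (crossing R (twoBoxes x y))ᶜ with hM
  have b1 : ∀ Z, M.Vanishes Z ∨ Z ⊆ box x y ∨ Z ⊆ box y x ∨ Z ⊆ (box x y ∪ box y x)ᶜ := fun Z => by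
    by_cases hd : diam Z ≤ R
    · by_cases hc : Z ∈ crossing R (twoBoxes x y)
      · exact Or.inl (L.restrict_vanishes_of_notMem (P := (crossing R (twoBoxes x y))ᶜ)
          fun h => h hc)
      · by_cases h3 : Z ⊆ twoBoxes x y
        · exact Or.inr ((subset_box_of_diam hR hfin h3 hd).imp_right Or.inl)
        · refine Or.inr (Or.inr (Or.inr fun w hw hw' => hc ⟨hd, ⟨w, hw', hw⟩, ?_⟩))
          obtain ⟨w', h4, h5⟩ := Set.not_subset.1 h3
          exact ⟨w', h5, h4⟩
    · exact Or.inl (M.vanishes_of_diam hd)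
  have b2 : ∀ Z, B₁.Vanishes Z ∨ Z ⊆ box x y ∨ Z ⊆ box y x ∨ Z ⊆ (box x y ∪ box y x)ᶜ :=
    fun Z => by
      by_cases hZ : Z ∈ innerBoundary δ R (twoBoxes x y)
      · exact Or.inr ((subset_box_of_diam hR hfin hZ.1 hZ.2.1).imp_right Or.inl)
      · exact Or.inl (h₁ Z hZ)
  have e1 := M.inner_lindbladian_block hdis b1 hu hv σ
  have e2 := B₁.inner_lindbladian_block hdis b2 hu hv σ
  have e3 : ⟪delta u, B₂.lindbladian σ (delta v)⟫ = 0 := by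
    refine B₂.inner_lindbladian_eq_zero (fun Z => ?_) σ
    by_cases hZ : Z ∈ innerBoundary δ R (twoBoxes x y)ᶜ
    · exact ⟨fun h => hZ.1 (B₂.termSupport_subset Z h) (Or.inl hu),
        fun h => hZ.1 (B₂.termSupport_subset Z h) (Or.inr hv)⟩
    · exact ⟨LocalLindbladian.Vanishes.notMem_termSupport (h₂ Z hZ) _,
        LocalLindbladian.Vanishes.notMem_termSupport (h₂ Z hZ) _⟩
  have e4 : ∀ S ⊆ twoBoxes x y, (M.restrict {Z | Z ⊆ S}).effective =
      (L.restrict {Z | Z ⊆ S}).effective := fun S hS =>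
    LocalLindbladian.effective_congr fun Z => by
      by_cases hZ : Z ⊆ S
      · have h3 : Z ∈ (crossing R (twoBoxes x y))ᶜ := fun h => by
          obtain ⟨w, hw, hw'⟩ := h.2.2
          exact hw (hS (hZ hw'))
        rw [M.restrict_effTerm_of_mem (P := {Z | Z ⊆ S}) hZ, hM, L.restrict_effTerm_of_mem h3,
          L.restrict_effTerm_of_mem (P := {Z | Z ⊆ S}) hZ]
      · rw [M.restrict_effTerm_of_notMem (P := {Z | Z ⊆ S}) hZ,
          L.restrict_effTerm_of_notMem (P := {Z | Z ⊆ S}) hZ]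
  -- By admissibility, restricting further to the inner boundary of `Λ₁` discards only zero terms.
  have e5 : ∀ S, (B₁.restrict {Z | Z ⊆ S}).effective =
      (B₁.restrict {Z | Z ⊆ S ∧ Z ∈ innerBoundary δ R (twoBoxes x y)}).effective := fun S =>
    LocalLindbladian.effective_congr fun Z => by
      by_cases hZ : Z ⊆ S
      · by_cases hZ' : Z ∈ innerBoundary δ R (twoBoxes x y)
        · rw [B₁.restrict_effTerm_of_mem (P := {Z | Z ⊆ S}) hZ, B₁.restrict_effTerm_of_mem
            (P := {Z | Z ⊆ S ∧ Z ∈ innerBoundary δ R (twoBoxes x y)}) ⟨hZ, hZ'⟩]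
        · rw [B₁.restrict_effTerm_of_mem (P := {Z | Z ⊆ S}) hZ, B₁.restrict_effTerm_of_notMem
            (P := {Z | Z ⊆ S ∧ Z ∈ innerBoundary δ R (twoBoxes x y)}) (fun h => hZ' h.2),
            LocalLindbladian.Vanishes.effTerm (h₁ Z hZ')]
      · rw [B₁.restrict_effTerm_of_notMem (P := {Z | Z ⊆ S}) hZ, B₁.restrict_effTerm_of_notMem
            (P := {Z | Z ⊆ S ∧ Z ∈ innerBoundary δ R (twoBoxes x y)}) (fun h => hZ h.1)]
  rw [L.inner_lindbladian_restrict (crossing R (twoBoxes x y)) σ, ← hM, e1,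
    e4 _ Set.subset_union_left, e4 _ Set.subset_union_right]
  rw [e5, e5] at e2
  simp only [LocalLindbladian.boundaryOp, fullGen, sub_apply, add_apply, star_add, map_add,
    inner_add_right, inner_sub_right, e2, e3]
  ring

/-- No term of `ℒ_∂` acts on `u` or `v`. A crossing set through either would bring `Λ₂` within `R ≤
r`, a term of `ℬ_{Λ₁}` within `r` by hypothesis, and the terms of `ℬ_{Λ₂}` stay inside `Λ₂`. -/
theorem inner_boundaryOp_eq_zero (hδ : δ = ambientDist ∨ δ = gdist)
    (h₂ : B₂.IsBoundary δ (twoBoxes x y)ᶜ) {r : ℕ}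
    (hr : R ≤ r) (hB : B₁.ActsWithin δ (twoBoxes x y) r) {u v : Λ} (hu : u ∈ box x y)
    (hv : v ∈ box y x) (hu' : u ∉ rBoundary δ r (box x y)) (hv' : v ∉ rBoundary δ r (box y x))
    (σ : Op Λ) : ⟪delta u, L.boundaryOp B₁ B₂ (twoBoxes x y) σ (delta v)⟫ = 0 := by
  have key : ∀ w w', (w = u ∨ w = v) → w' ∉ twoBoxes x y → ¬ δ w w' ≤ r := by
    rintro w w' (rfl | rfl) hw' h
    · exact hu' (mem_rBoundary_of_mem hδ hu (fun h' => hw' (Or.inl h')) h)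
    · exact hv' (mem_rBoundary_of_mem hδ hv (fun h' => hw' (Or.inr h')) h)
  have mem : ∀ w, (w = u ∨ w = v) → w ∈ twoBoxes x y := by
    rintro w (rfl | rfl)
    exacts [Or.inl hu, Or.inr hv]
  have e1 : ⟪delta u, (L.restrict (crossing R (twoBoxes x y))).lindbladian σ (delta v)⟫ = 0 := by
    have h3 : ∀ Z w, (w = u ∨ w = v) →
        w ∉ (L.restrict (crossing R (twoBoxes x y))).termSupport Z := fun Z w hw h => by
      by_cases hZ : Z ∈ crossing R (twoBoxes x y)
      · obtain ⟨w', hw1, hw2⟩ := hZ.2.2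
        refine key w w' hw hw1 ((le_gdist hδ w w').trans ((gdist_le_diam
          (LocalLindbladian.termSupport_subset _ Z h) hw2).trans (hZ.1.trans ?_)))
        exact_mod_cast hr
      · exact (L.restrict_vanishes_of_notMem hZ).notMem_termSupport w h
    exact LocalLindbladian.inner_lindbladian_eq_zero _
      (fun Z => ⟨h3 Z u (Or.inl rfl), h3 Z v (Or.inr rfl)⟩) σ
  have e2 : ⟪delta u, B₁.lindbladian σ (delta v)⟫ = 0 := by
    have h3 : ∀ Z w, (w = u ∨ w = v) → w ∉ B₁.termSupport Z := fun Z w hw h => by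
      obtain ⟨_, rfl, w', hw1, hw2⟩ := setDist_le_iff.1 (hB Z w h)
      exact key _ w' hw hw1 hw2
    exact B₁.inner_lindbladian_eq_zero (fun Z => ⟨h3 Z u (Or.inl rfl), h3 Z v (Or.inr rfl)⟩) σ
  have e3 : ⟪delta u, B₂.lindbladian σ (delta v)⟫ = 0 := by
    have h3 : ∀ Z w, (w = u ∨ w = v) → w ∉ B₂.termSupport Z := fun Z w hw h => by
      by_cases hZ : Z ∈ innerBoundary δ R (twoBoxes x y)ᶜ
      · exact hZ.1 (B₂.termSupport_subset Z h) (mem w hw)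
      · exact LocalLindbladian.Vanishes.notMem_termSupport (h₂ Z hZ) _ h
    exact B₂.inner_lindbladian_eq_zero (fun Z => ⟨h3 Z u (Or.inl rfl), h3 Z v (Or.inr rfl)⟩) σ
  simp only [LocalLindbladian.boundaryOp, sub_apply, inner_sub_right, e1, e2, e3, sub_zero]

end Boundary

/-! ### The kernel representation -/

theorem finite_box {x y : Λ} (hfin : gdist x y ≠ ⊤) : (box x y).Finite := by
  obtain ⟨n, hn⟩ := ENat.ne_top_iff_exists.1 hfin
  obtain ⟨M, hM⟩ := exists_ball (Λ := Λ) n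
  obtain ⟨B, -, hB⟩ := hM x
  refine B.finite_toSet.subset fun u hu => hB u ?_
  have h1 : 3 * gdist x u ≤ gdist x y := hu
  rw [hn]
  exact (le_mul_of_one_le_left zero_le (by norm_num)).trans h1

section Kernel

variable {δ : Λ → Λ → ℕ∞} {x y : Λ} {L B : LocalLindbladian Λ R I N} {ε : ℝ} {γ : ℝ → ℂ}

/-- The contour solution of the Sylvester equation, read at the entry `(x, y)`. The right-hand side
`F` is left free so that it can later be written as `ε ρ + ℒ_∂ σ`. -/
theorem inner_eq_sum_kernel [Fintype (box x y)] [Fintype (box y x)]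
    (hγ : IsContour γ {z | z.re < ε}
      (spectrum ℂ (dissipativeGen L B δ (twoBoxes x y) (box x y)))) (σ : Op Λ) {F : Λ → Λ → ℂ}
    (hF : ∀ u ∈ box x y, ∀ v ∈ box y x, F u v = ε * ⟪delta u, σ (delta v)⟫ -
      (⟪delta u, fullGen L B δ (twoBoxes x y) (box x y) (σ (delta v))⟫ +
        ⟪delta u, σ (star (fullGen L B δ (twoBoxes x y) (box y x)) (delta v))⟫)) :
    ⟪delta x, σ (delta y)⟫ =
      ∑ u : box x y, ∑ v : box y x, kernel L B δ x y ε γ u v * F u v := by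
  have := finiteDimensional_ell2On (box x y).toFinite
  have := finiteDimensional_ell2On (box y x).toFinite
  set D := dissipativeGen L B δ (twoBoxes x y) (box x y) with hD
  set D' := star (dissipativeGen L B δ (twoBoxes x y) (box y x)) with hD'
  set ex := deltaOn (box x y) ⟨x, mem_box_self x y⟩ with hex
  set ey := deltaOn (box y x) ⟨y, mem_box_self y x⟩ with hey
  set W := block (box x y) (box y x) σ with hW
  let Y : ell2On (box y x) →L[ℂ] ell2On (box x y) := (ε : ℂ) • W - D ∘L W - W ∘L D'
  have hY : ∀ (u : box x y) (v : box y x),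
      ⟪deltaOn (box x y) u, Y (deltaOn (box y x) v)⟫ = F u v := fun u v => by
    have h1 : Y (deltaOn (box y x) v) = (ε : ℂ) • W (deltaOn (box y x) v) -
      D (W (deltaOn (box y x) v)) - W (D' (deltaOn (box y x) v)) := rfl
    have h2 : ⟪deltaOn (box x y) u, D (W (deltaOn (box y x) v))⟫ = _ :=
      inner_compress_block (star_fullGen_mem _ _ _ _ _ _) σ _
    have h3 : ⟪deltaOn (box x y) u, W (D' (deltaOn (box y x) v))⟫ = _ :=
      inner_block_star_compress (star_fullGen_mem _ _ _ _ _ _) σ _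
    have h4 : ⟪deltaOn (box x y) u, W (deltaOn (box y x) v)⟫ = _ := inner_block σ _ _
    rw [h1, inner_sub_on, inner_sub_on, inner_smul_on, hF u u.2 v v.2, h2, h3, h4, ← sub_sub]
    rfl
  have hl := hγ.isLoop
  have hη : ∀ t ∈ Set.Icc (0 : ℝ) 1, (γ t).re < ε ∧ γ t ∉ spectrum ℂ D := hγ.subset
  have hpi : (2 * Real.pi * Complex.I) ≠ 0 := Complex.two_pi_I_ne_zero
  have hspec : ∀ w ∈ spectrum ℂ D', w.re ≤ 0 := fun w hw =>
    re_le_zero_of_mem_spectrum (box y x).toFinite hw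
  have h1 := hl.integral_sylvester (D := D) (D' := D') (W := W) (Y := Y) hη
    (fun w hw => by
      have h2 := hγ.winding w hw
      rw [inv_mul_eq_iff_eq_mul₀ hpi, mul_one] at h2
      simpa only [div_eq_mul_inv] using h2) hspec (fun _ => rfl) ey
  have hR := hl.continuousOn_resolvent fun t ht => (hη t ht).2
  have hR' := (hl.const_sub (ε : ℂ)).continuousOn_resolvent (D := D') fun t ht hs =>
    (hspec _ hs).not_gt (by simpa using (hη t ht).1)
  have hf : IntervalIntegrable
      (fun t => deriv γ t • resolvent D (γ t) (Y (resolvent D' (ε - γ t) ey)))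
      MeasureTheory.volume 0 1 :=
    hl.intervalIntegrable_smul (hR.clm_apply
      (Y.continuous.comp_continuousOn (hR'.clm_apply continuousOn_const)))
  have h2 := ((innerSL ℂ ex).intervalIntegral_comp_comm hf).trans (congrArg (innerSL ℂ ex) h1)
  have h3 : innerSL ℂ ex ((2 * Real.pi * Complex.I) • W ey) =
      (2 * Real.pi * Complex.I) * ⟪delta x, σ (delta y)⟫ := by
    refine (inner_smul_on _ _ _).trans ?_
    rw [hW, inner_block]
    rfl
  have h4 : ∀ t, innerSL ℂ ex (deriv γ t • resolvent D (γ t) (Y (resolvent D' (ε - γ t) ey))) =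
      ∑ u : box x y, ∑ v : box y x, (⟪ex, resolvent D (γ t) (deltaOn (box x y) u)⟫ *
        ⟪deltaOn (box y x) v, resolvent D' (ε - γ t) ey⟫ * deriv γ t) * F u v := fun t => by
    refine (inner_smul_on _ _ _).trans ?_
    rw [inner_comp_eq_sum, Finset.mul_sum]
    refine Finset.sum_congr rfl fun u _ => ?_
    rw [Finset.mul_sum]
    refine Finset.sum_congr rfl fun v _ => ?_
    rw [hY]
    ring
  have hint : ∀ (u : box x y) (v : box y x), IntervalIntegrable (fun t =>
      (⟪ex, resolvent D (γ t) (deltaOn (box x y) u)⟫ *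
        ⟪deltaOn (box y x) v, resolvent D' (ε - γ t) ey⟫ * deriv γ t) * F u v)
      MeasureTheory.volume 0 1 := fun u v => by
    have c1 : ContinuousOn (fun t => ⟪ex, resolvent D (γ t) (deltaOn (box x y) u)⟫)
        (Set.Icc 0 1) :=
      (innerSL ℂ ex).continuous.comp_continuousOn (hR.clm_apply continuousOn_const)
    have c2 : ContinuousOn (fun t => ⟪deltaOn (box y x) v, resolvent D' (ε - γ t) ey⟫)
        (Set.Icc 0 1) :=
      (innerSL ℂ (deltaOn (box y x) v)).continuous.comp_continuousOn
        (hR'.clm_apply continuousOn_const)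
    have := (hl.intervalIntegrable_smul (c1.mul c2)).mul_const (F u v)
    refine this.congr fun t _ => ?_
    simp only [smul_eq_mul, Pi.mul_apply]
    ring
  have hint' : ∀ u : box x y, IntervalIntegrable (fun t => ∑ v : box y x,
      (⟪ex, resolvent D (γ t) (deltaOn (box x y) u)⟫ *
        ⟪deltaOn (box y x) v, resolvent D' (ε - γ t) ey⟫ * deriv γ t) * F u v)
      MeasureTheory.volume 0 1 := fun u => by
    have := IntervalIntegrable.sum Finset.univ fun v _ => hint u v
    rwa [Finset.sum_fn] at this
  simp only [h4] at h2
  rw [intervalIntegral.integral_finsetSum fun u _ => hint' u, h3, ← inv_mul_eq_iff_eq_mul₀ hpi, Finset.mul_sum] at h2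
  rw [← h2]
  refine Finset.sum_congr rfl fun u _ => ?_
  rw [intervalIntegral.integral_finsetSum fun v _ => hint u v, Finset.mul_sum]
  refine Finset.sum_congr rfl fun v _ => ?_
  rw [intervalIntegral.integral_mul_const, ← mul_assoc]
  rfl

theorem norm_inner_delta_le (A : Op Λ) (u v : Λ) : ‖⟪delta u, A (delta v)⟫‖ ≤ ‖A‖ := by
  refine (norm_inner_le_norm _ _).trans ?_
  rw [norm_delta, one_mul]
  simpa [norm_delta] using A.le_opNorm (delta v)

theorem norm_inner_abelAverage_sub_le {B₁ B₂ : LocalLindbladian Λ R I N}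
    (hδ : δ = ambientDist ∨ δ = gdist)
    (hR : ((3 * R : ℕ) : ℕ∞) < gdist x y) (hfin : gdist x y ≠ ⊤)
    (h₁ : B₁.IsBoundary δ (twoBoxes x y)) (h₂ : B₂.IsBoundary δ (twoBoxes x y)ᶜ) {r : ℕ}
    (hr : R ≤ r) (hB : B₁.ActsWithin δ (twoBoxes x y) r) {ρ : Op Λ} (hρ : IsState ρ) (hε : 0 < ε)
    (hγ : IsContour γ {z | z.re < ε}
      (spectrum ℂ (dissipativeGen L B₁ δ (twoBoxes x y) (box x y)))) :
    ‖⟪delta x, L.abelAverage ε ρ (delta y)⟫ -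
        (ε : ℂ) * ∑' (u : box x y) (v : box y x),
          kernel L B₁ δ x y ε γ u v * ⟪delta (u : Λ), ρ (delta (v : Λ))⟫‖ ≤
      ∑' (u : box x y) (v : box y x),
        (open Classical in
          if (u : Λ) ∈ rBoundary δ r (box x y) ∨ (v : Λ) ∈ rBoundary δ r (box y x) then
            ‖kernel L B₁ δ x y ε γ u v‖ * ‖L.boundaryOp B₁ B₂ (twoBoxes x y)‖
          else 0) := by
  have := (finite_box hfin).fintype
  have := (finite_box (x := y) (y := x) (by rwa [gdist_comm])).fintype
  simp only [tsum_fintype]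
  set σ := L.abelAverage ε ρ with hσ
  -- By the Abel equation `ε σ - ℒ σ = ε ρ`, the Sylvester defect of `σ` is the block of `ε ρ + ℒ_∂
  -- σ`; the `ρ` part then cancels against the main term.
  have hF := inner_eq_sum_kernel hγ σ (F := fun u v =>
      ε * ⟪delta u, ρ (delta v)⟫ + ⟪delta u, L.boundaryOp B₁ B₂ (twoBoxes x y) σ (delta v)⟫)
    fun u hu v hv => by
      have h1 := inner_lindbladian_eq (L := L) hR hfin h₁ h₂ hu hv σ
      have h2 := congrArg (fun A : Op Λ => ⟪delta u, A (delta v)⟫) (L.abelAverage_equation hρ hε)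
      simp only [sub_apply, smul_apply, inner_sub_right, inner_smul_right] at h2
      rw [← h2, h1]
      ring
  rw [hF, Finset.mul_sum, ← Finset.sum_sub_distrib]
  refine (norm_sum_le _ _).trans (Finset.sum_le_sum fun u _ => ?_)
  rw [Finset.mul_sum, ← Finset.sum_sub_distrib]
  refine (norm_sum_le _ _).trans (Finset.sum_le_sum fun v _ => ?_)
  have h1 : kernel L B₁ δ x y ε γ u v * (ε * ⟪delta (u : Λ), ρ (delta (v : Λ))⟫ +
      ⟪delta (u : Λ), L.boundaryOp B₁ B₂ (twoBoxes x y) σ (delta (v : Λ))⟫) -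
      ε * (kernel L B₁ δ x y ε γ u v * ⟪delta (u : Λ), ρ (delta (v : Λ))⟫) =
      kernel L B₁ δ x y ε γ u v *
        ⟪delta (u : Λ), L.boundaryOp B₁ B₂ (twoBoxes x y) σ (delta (v : Λ))⟫ := by ring
  rw [h1, norm_mul]
  split_ifs with h
  · refine mul_le_mul_of_nonneg_left ((norm_inner_delta_le _ _ _).trans ?_) (norm_nonneg _)
    refine ((L.boundaryOp B₁ B₂ (twoBoxes x y)).le_opNorm σ).trans ?_
    exact mul_le_of_le_one_right (norm_nonneg _) (L.norm_abelAverage_le hρ hε)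
  · rw [not_or] at h
    rw [inner_boundaryOp_eq_zero hδ h₂ hr hB u.2 v.2 h.1 h.2, norm_zero, mul_zero]

end Kernel

/-! ### The norm of the boundary operator -/

theorem abs_sub_le_of_ambientDist {u v : Λ} {r : ℕ} (h : ambientDist u v ≤ r) (i : Fin d) :
    |(u : Fin d → ℤ) i - (v : Fin d → ℤ) i| ≤ r := by
  -- The ambient distance is the intrinsic one for `Λ = ℤ^d`, which gives the coordinate bound.
  have h1 : gdist (⟨u.1, trivial⟩ : (Set.univ : Set (Fin d → ℤ))) ⟨v.1, trivial⟩ ≤ r := by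
    refine le_trans ?_ h
    by_cases hn : ambientDist u v = ⊤
    · rw [hn]; exact le_top
    · obtain ⟨p, hp⟩ := SimpleGraph.exists_walk_of_edist_ne_top hn
      rw [ambientDist, ← hp]
      have := SimpleGraph.edist_le
        (p.map (SimpleGraph.induceUnivIso (latticeGraph d)).symm.toHom)
      rwa [SimpleGraph.Walk.length_map] at this
  exact abs_sub_le_of_gdist h1 i

/-- The sites within coordinatewise distance `r`. -/
theorem exists_ambient_ball (r : ℕ) (u : Λ) : ∃ B : Finset Λ, B.card ≤ (2 * r + 1) ^ d ∧
    ∀ v, ambientDist u v ≤ r → v ∈ B := by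
  classical
  let B' : Finset (Fin d → ℤ) := Fintype.piFinset fun i =>
    Finset.Icc ((u : Fin d → ℤ) i - r) ((u : Fin d → ℤ) i + r)
  refine ⟨B'.preimage Subtype.val Subtype.val_injective.injOn, ?_, fun v hv => ?_⟩
  · have h1 : (B'.preimage (Subtype.val : Λ → _) Subtype.val_injective.injOn).card ≤ B'.card :=
      Finset.card_le_card_of_injOn Subtype.val (fun a ha => by simpa using ha)
        Subtype.val_injective.injOn
    refine h1.trans ?_
    simp only [B', Fintype.card_piFinset, Int.card_Icc]
    refine (Finset.prod_le_pow_card _ _ (2 * r + 1) fun i _ => ?_).trans (by simp)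
    omega
  · simp only [Finset.mem_preimage, B', Fintype.mem_piFinset, Finset.mem_Icc]
    intro i
    have := abs_le.1 (abs_sub_le_of_ambientDist hv i)
    constructor <;> linarith [this.1, this.2]

theorem ambientDist_comm (u v : Λ) : ambientDist u v = ambientDist v u := SimpleGraph.edist_comm

theorem finite_rBoundary {δ : Λ → Λ → ℕ∞} (hδ : δ = ambientDist ∨ δ = gdist) {S : Set Λ}
    (hS : S.Finite) (r : ℕ) : (rBoundary δ r S).Finite := by
  choose B _ hB using exists_ambient_ball (Λ := Λ) r
  refine (hS.biUnion fun w _ => (B w).finite_toSet).subset fun u hu => ?_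
  obtain ⟨⟨w, hw, h⟩, -⟩ := mem_rBoundary_iff.1 hu
  refine Set.mem_biUnion hw (hB w u ?_)
  rw [ambientDist_comm]
  exact (ambientDist_le hδ u w).trans h

/-- The number of sets of diameter at most `R` meeting a given finite set. -/
theorem exists_finset_of_meets (R : ℕ) {S : Set Λ} (hS : S.Finite) :
    ∃ F : Finset (Set Λ), (∀ Z, diam Z ≤ R → (S ∩ Z).Nonempty → Z ∈ F) ∧
      F.card ≤ S.ncard * 2 ^ (2 * R + 1) ^ d := by
  classical
  choose B hBc hB using exists_ambient_ball (Λ := Λ) R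
  -- A set of diameter at most `R` through `u` is a subset of a ball with at most `(2R+1)^d` sites.
  refine ⟨hS.toFinset.biUnion fun u => (B u).powerset.image fun s : Finset Λ => (s : Set Λ), ?_, ?_⟩
  · rintro Z hZ ⟨u, hu, huZ⟩
    refine Finset.mem_biUnion.2 ⟨u, hS.mem_toFinset.2 hu, Finset.mem_image.2
      ⟨(finite_of_diam hZ).toFinset, Finset.mem_powerset.2 fun v hv => hB u v ?_, by simp⟩⟩
    exact (ambientDist_le_gdist u v).trans ((gdist_le_diam huZ (by simpa using hv)).trans hZ)
  · rw [Set.ncard_eq_toFinset_card S hS]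
    refine Finset.card_biUnion_le_card_mul _ _ _ fun u _ => ?_
    refine Finset.card_image_le.trans ?_
    rw [Finset.card_powerset]
    exact Nat.pow_le_pow_right (by norm_num) (hBc u)

theorem LocalLindbladian.norm_lindbladian_le (L : LocalLindbladian Λ R I N) {F : Finset (Set Λ)}
    (hF : ∀ Z ∉ F, L.Vanishes Z) :
    ‖L.lindbladian‖ ≤ F.card * (2 * N + 3 * (I * N ^ 2)) := by
  have hN := L.nonneg_bound
  refine L.lindbladian.opNorm_le_bound (by positivity) fun ρ => ?_
  have h1 : L.lindbladian ρ = ∑ Z ∈ F, L.term Z ρ := by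
    refine ContinuousLinearMap.ext fun ψ => ext_inner_left ℂ fun φ => ?_
    refine (L.hasSum_inner_lindbladian ρ φ ψ).unique ?_
    rw [sum_apply, inner_sum]
    exact hasSum_sum_of_ne_finset_zero fun Z hZ => by simp [(hF Z hZ).term]
  rw [h1, mul_assoc, ← nsmul_eq_mul]
  exact (norm_sum_le _ _).trans (Finset.sum_le_card_nsmul _ _ _ fun Z _ => L.norm_term_le Z ρ)

theorem rBoundary_zero {δ : Λ → Λ → ℕ∞} (hδ : δ = ambientDist ∨ δ = gdist) (S : Set Λ) :
    rBoundary δ 0 S = ∅ := by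
  refine Set.eq_empty_of_forall_notMem fun u hu => ?_
  obtain ⟨⟨v, hv, h1⟩, w, hw, h2⟩ := mem_rBoundary_iff.1 hu
  have h : ∀ w, δ u w ≤ (0 : ℕ) → u = w := fun w h => by
    have h3 : ambientDist u w = 0 := le_antisymm ((ambientDist_le hδ u w).trans h) zero_le
    exact Subtype.ext (SimpleGraph.edist_eq_zero_iff.1 h3)
  exact hw (h w h2 ▸ h v h1 ▸ hv)

/-- A walk from `x` to `y` inside `Λ` has an edge leaving the box; its inner endpoint is at distance
at most `1 ≤ R` from the complement. -/
theorem one_le_ncard_rBoundary {δ : Λ → Λ → ℕ∞} (hδ : δ = ambientDist ∨ δ = gdist) {x y : Λ}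
    (hfin : gdist x y ≠ ⊤) (hxy : y ∉ box x y) (hR : 1 ≤ R) :
    1 ≤ (rBoundary δ R (box x y)).ncard := by
  obtain ⟨p, -⟩ := SimpleGraph.exists_walk_of_edist_ne_top hfin
  obtain ⟨e, he, h1, h2⟩ := p.exists_boundary_dart (box x y) (mem_box_self x y) hxy
  refine Nat.one_le_iff_ne_zero.2 (Set.ncard_ne_zero_of_mem (a := e.fst)
    (mem_rBoundary_of_mem hδ h1 h2 ((le_gdist hδ _ _).trans ?_))
    (finite_rBoundary hδ (finite_box hfin) R))
  have h3 : gdist e.fst e.snd ≤ 1 := by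
    have := SimpleGraph.edist_le (SimpleGraph.Walk.cons e.adj SimpleGraph.Walk.nil)
    simpa [gdist] using this
  exact h3.trans (by exact_mod_cast hR)

theorem norm_boundaryOp_le {δ : Λ → Λ → ℕ∞} (hδ : δ = ambientDist ∨ δ = gdist) {x y : Λ}
    (hR : ((3 * R : ℕ) : ℕ∞) < gdist x y) (hfin : gdist x y ≠ ⊤)
    {L B₁ B₂ : LocalLindbladian Λ R I N}
    (h₁ : B₁.IsBoundary δ (twoBoxes x y)) (h₂ : B₂.IsBoundary δ (twoBoxes x y)ᶜ) :
    ‖L.boundaryOp B₁ B₂ (twoBoxes x y)‖ ≤ (18 * 2 ^ (2 * R + 1) ^ d) * N * (1 + I * N) *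
      (rBoundary δ R (box x y)).ncard * (rBoundary δ R (box y x)).ncard := by
  have hN := L.nonneg_bound
  have hfin' : gdist y x ≠ ⊤ := by rwa [gdist_comm]
  set a := (rBoundary δ R (box x y)).ncard with ha
  set b := (rBoundary δ R (box y x)).ncard with hb
  obtain ⟨F, hF, hFc⟩ := exists_finset_of_meets R
    ((finite_rBoundary hδ (finite_box hfin) R).union (finite_rBoundary hδ (finite_box hfin') R))
  have hcard : (F.card : ℝ) ≤ (a + b) * 2 ^ (2 * R + 1) ^ d := by
    exact_mod_cast hFc.trans (Nat.mul_le_mul_right _ (Set.ncard_union_le _ _))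
  have hmem : ∀ u w, u ∈ twoBoxes x y → w ∉ twoBoxes x y → δ u w ≤ R →
      u ∈ rBoundary δ R (box x y) ∪ rBoundary δ R (box y x) := by
    rintro u w (hu | hu) hw h
    · exact Or.inl (mem_rBoundary_of_mem hδ hu (fun h' => hw (Or.inl h')) h)
    · exact Or.inr (mem_rBoundary_of_mem hδ hu (fun h' => hw (Or.inr h')) h)
  have hself : ∀ u, δ u u ≤ R := fun u => (le_gdist hδ u u).trans (by rw [gdist_self]; exact zero_le)
  have hmem' : ∀ u w, u ∉ twoBoxes x y → w ∈ twoBoxes x y → δ u w ≤ R →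
      u ∈ rBoundary δ R (box x y) ∪ rBoundary δ R (box y x) := by
    rintro u w hu (hw | hw) h
    · exact Or.inl (mem_rBoundary_iff.2 ⟨⟨w, hw, h⟩, u, fun h' => hu (Or.inl h'), hself u⟩)
    · exact Or.inr (mem_rBoundary_iff.2 ⟨⟨w, hw, h⟩, u, fun h' => hu (Or.inr h'), hself u⟩)
  have v0 : ∀ Z ∉ F, (L.restrict (crossing R (twoBoxes x y))).Vanishes Z := fun Z hZ => by
    refine L.restrict_vanishes_of_notMem fun hc => hZ ?_
    obtain ⟨hd, ⟨u, hu, huZ⟩, w, hw, hwZ⟩ := hc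
    exact hF Z hd ⟨u, hmem u w hu hw ((le_gdist hδ u w).trans ((gdist_le_diam huZ hwZ).trans hd)),
      huZ⟩
  have v1 : ∀ Z ∉ F, B₁.Vanishes Z := fun Z hZ => h₁ Z fun hc => hZ (by
    obtain ⟨u, hu, w, hw, h⟩ := setDist_le_iff.1 hc.2.2
    exact hF Z hc.2.1 ⟨u, hmem u w (hc.1 hu) hw h, hu⟩)
  have v2 : ∀ Z ∉ F, B₂.Vanishes Z := fun Z hZ => h₂ Z fun hc => hZ (by
    obtain ⟨u, hu, w, hw, h⟩ := setDist_le_iff.1 hc.2.2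
    exact hF Z hc.2.1 ⟨u, hmem' u w (hc.1 hu) (not_not.1 hw) h, hu⟩)
  have n0 := LocalLindbladian.norm_lindbladian_le _ v0
  have n1 := LocalLindbladian.norm_lindbladian_le _ v1
  have n2 := LocalLindbladian.norm_lindbladian_le _ v2
  -- The constant `18` is `3 · 2 · 3`: three Lindbladians, the factor in `a + b ≤ 2ab`, and `2N +
  -- 3IN² ≤ 3N(1 + IN)`.
  have h3 : ‖L.boundaryOp B₁ B₂ (twoBoxes x y)‖ ≤ 3 * (F.card * (2 * N + 3 * (I * N ^ 2))) := by
    have t1 := norm_sub_le ((L.restrict (crossing R (twoBoxes x y))).lindbladian - B₁.lindbladian)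
      B₂.lindbladian
    have t2 := norm_sub_le (L.restrict (crossing R (twoBoxes x y))).lindbladian B₁.lindbladian
    rw [LocalLindbladian.boundaryOp]
    linarith
  -- For `R ≥ 1` both boundaries are nonempty, so `a, b ≥ 1`. For `R = 0` both are empty, since a
  -- site at distance `0` from a set belongs to it.
  have hab : (a + b : ℝ) ≤ 2 * (a * b) := by
    rcases Nat.eq_zero_or_pos R with rfl | h0
    · rw [ha, hb, rBoundary_zero hδ, rBoundary_zero hδ]
      simp
    · have hne : ∀ {x y : Λ}, ((3 * R : ℕ) : ℕ∞) < gdist x y → gdist x y ≠ ⊤ → y ∉ box x y :=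
        fun h h' hm => (disjoint_box h h').notMem_of_mem_left hm (mem_box_self _ _)
      have h1 : (1 : ℝ) ≤ a := by
        exact_mod_cast one_le_ncard_rBoundary hδ hfin (hne hR hfin) h0
      have h2 : (1 : ℝ) ≤ b := by
        exact_mod_cast one_le_ncard_rBoundary hδ hfin'
          (hne (by rwa [gdist_comm]) hfin') h0
      nlinarith
  have hP : (0 : ℝ) ≤ 2 ^ (2 * R + 1) ^ d := by positivity
  have h4 : 2 * N + 3 * (I * N ^ 2) ≤ 3 * (N * (1 + I * N)) := by linarith
  have h5 : (F.card : ℝ) ≤ 2 * (a * b) * 2 ^ (2 * R + 1) ^ d :=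
    hcard.trans (mul_le_mul_of_nonneg_right hab hP)
  calc _ ≤ 3 * (F.card * (2 * N + 3 * (I * N ^ 2))) := h3
    _ ≤ 3 * (2 * (a * b) * 2 ^ (2 * R + 1) ^ d * (3 * (N * (1 + I * N)))) := by
        refine mul_le_mul_of_nonneg_left (mul_le_mul h5 h4 ?_ ?_) (by norm_num) <;> positivity
    _ = _ := by ring

end OpenLattice

/-! ### The main theorem -/

open OpenLattice

theorem mainTheorem1 (d R : ℕ) : ∃ C : ℝ,
    ∀ (Λ : Set (Fin d → ℤ)) (δ : Λ → Λ → ℕ∞), (δ = ambientDist ∨ δ = gdist) →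
    ∀ (I : ℕ) (N : ℝ) (L : LocalLindbladian Λ R I N) (x y : Λ),
      ((3 * R : ℕ) : ℕ∞) < gdist x y → gdist x y ≠ ⊤ →
      ∀ B₁ B₂ : LocalLindbladian Λ R I N,
        B₁.IsBoundary δ (twoBoxes x y) → B₂.IsBoundary δ (twoBoxes x y)ᶜ →
        (∀ r : ℕ, R ≤ r → B₁.ActsWithin δ (twoBoxes x y) r →
          ∀ (ρ : Op Λ), IsState ρ → ∀ ε : ℝ, 0 < ε → ∀ γ : ℝ → ℂ,
            IsContour γ {z | z.re < ε}
              (spectrum ℂ (dissipativeGen L B₁ δ (twoBoxes x y) (box x y))) →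
            MeasureTheory.IntegrableOn (fun t : ℝ =>
              (Real.exp (-t * ε) : ℂ) • L.evolution t ρ) (Set.Ioi 0) ∧
            ‖inner ℂ (delta x) (L.abelAverage ε ρ (delta y)) -
                (ε : ℂ) * ∑' (u : box x y) (v : box y x),
                  kernel L B₁ δ x y ε γ u v * inner ℂ (delta (u : Λ)) (ρ (delta (v : Λ)))‖ ≤
              ∑' (u : box x y) (v : box y x),
                (open Classical in
                  if (u : Λ) ∈ rBoundary δ r (box x y) ∨ (v : Λ) ∈ rBoundary δ r (box y x) then
                    ‖kernel L B₁ δ x y ε γ u v‖ * ‖L.boundaryOp B₁ B₂ (twoBoxes x y)‖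
                  else 0)) ∧
        ‖L.boundaryOp B₁ B₂ (twoBoxes x y)‖ ≤
          C * N * (1 + I * N) *
            (rBoundary δ R (box x y)).ncard * (rBoundary δ R (box y x)).ncard := by
  refine ⟨18 * 2 ^ (2 * R + 1) ^ d, fun Λ δ hδ I N L x y hR hfin B₁ B₂ h₁ h₂ =>
    ⟨fun r hr hB ρ hρ ε hε γ hγ => ⟨L.integrableOn_evolution hρ hε, ?_⟩,
      norm_boundaryOp_le hδ hR hfin h₁ h₂⟩⟩
  exact norm_inner_abelAverage_sub_le hδ hR hfin h₁ h₂ hr hB hρ hε hγ
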